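/- Let $\mathcal S,\mathcal A$ be finite sets and let $\mathcal M_f=(\mathcal S,\mathcal A,p,p_0,f)$ be an average general-utility Markov decision process: $p(\cdot\mid s,a)$ is a probability distribution on $\mathcal S$ for every $(s,a)\in\mathcal S\times\mathcal A$, $p_0$ is a probability distribution on $\mathcal S$, and $f:\Delta(\mathcal S\times\mathcal A)\to\mathbb R$ is a function on the probability simplex. Suppose that $f$ is $c$-strongly convex with respect to the Euclidean norm for some $c>0$, i.e. $$f(\lambda d_1+(1-\lambda)d_2)\le \lambda f(d_1)+(1-\lambda)f(d_2)-\tfrac c2\lambda(1-\lambda)\|d_1-d_2\|_2^2$$ for all $d_1,d_2\in\Delta(\mathcal S\times\mathcal A)$ and $\lambda\in[0,1]$ (for differentiable $f$ this is $f(d_1)\ge f(d_2)+\nabla f(d_2)^\top(d_1-d_2)+\frac c2\|d_1-d_2\|_2^2$). Let $\pi=\pi(\cdot\mid s)$ be a stationary policy, and let $\zeta_\pi$ be the law of the trajectory $T=(S_0,A_0,S_1,A_1,\dots)$ with $S_0\sim p_0$, $A_t\sim\pi(\cdot\mid S_t)$, $S_{t+1}\sim p(\cdot\mid S_t,A_t)$.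 For an integer $K\ge1$ let $T_1,\dots,T_K$ be independent with law $\zeta_\pi$, $T_k=(S_{k,0},A_{k,0},S_{k,1},A_{k,1},\dots)$, and put $$\hat d_{\mathcal T_K}(s,a)=\frac1K\sum_{k=1}^K\lim_{H\to\infty}\frac1H\sum_{t=0}^{H-1}\mathbf 1(S_{k,t}=s,A_{k,t}=a),\qquad d_\pi(s,a)=\lim_{H\to\infty}\frac1H\sum_{t=0}^{H-1}\mathbb P(S_t=s,A_t=a),$$ $$f_K(\pi)=\mathbb E\big[f(\hat d_{\mathcal T_K})\big],\qquad f_\infty(\pi)=f(d_\pi).$$ Consider the Markov chain on $\mathcal S$ with transition matrix $P^\pi(s,s')=\sum_a\pi(a\mid s)p(s'\mid s,a)$ and initial distribution $p_0$. Let $\mathcal R_1,\dots,\mathcal R_L$ be its recurrent classes (the communicating classes all of whose states are recurrent, a state being recurrent if the chain started there returns to it with probability one), let $\mu_l$ be the stationary distribution of $P^\pi$ carried by $\mathcal R_l$, and let $\alpha_l=\lim_{t\to\infty}\mathbb P(S_t\in\mathcal R_l\mid S_0\sim p_0)$ be the probability of absorption into $\mathcal R_l$. Then all these objects are well defined (each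 $\mu_l$ exists and is unique, the limits defining $d_\pi$ and $\alpha_l$ exist, the limits defining $\hat d_{\mathcal T_K}$ exist almost surely, and $f(\hat d_{\mathcal T_K})$ is integrable), and $$f_K(\pi)-f_\infty(\pi)\;\ge\;\frac{c}{2K}\sum_{l=1}^L\alpha_l(1-\alpha_l)\sum_{s\in\mathcal R_l}\sum_{a\in\mathcal A}\pi(a\mid s)^2\,\mu_l(s)^2 .$$ -/

import Mathlib

open MeasureTheory ProbabilityTheory Filter Topology

noncomputable section

/-! ### Finite Markov chains -/

section MarkovChain

variable {X : Type*} [Fintype X] [MeasurableSpace X] [MeasurableSingletonClass X]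

/-- The transition kernel from the history up to time `n` to the state at time `n + 1`,
for the time-homogeneous Markov chain with transition probabilities `P x y`. -/
def markovStep (P : X → PMF X) (n : ℕ) : Kernel (Finset.Iic n → X) X :=
  Kernel.ofFunOfCountable fun h => (P (h ⟨n, Finset.mem_Iic.2 le_rfl⟩)).toMeasure

instance markovStep.instIsMarkovKernel (P : X → PMF X) (n : ℕ) :
    IsMarkovKernel (markovStep P n) :=
  ⟨fun h => PMF.toMeasure.isProbabilityMeasure (P (h ⟨n, Finset.mem_Iic.2 le_rfl⟩))⟩

/-- The law on `ℕ → X` of the Markov chain with initial distribution `ν` and transition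
probabilities `P`. -/
def markovLaw (ν : PMF X) (P : X → PMF X) : Measure (ℕ → X) :=
  Kernel.trajMeasure (X := fun _ => X) ν.toMeasure (markovStep P)

/-- A state is recurrent if the chain started there returns to it with probability one. -/
def IsRecurrentState (P : X → PMF X) (x : X) : Prop :=
  markovLaw (PMF.pure x) P {ω | ∃ t : ℕ, 1 ≤ t ∧ ω t = x} = 1

/-- `y` is reachable from `x` through finitely many (possibly zero) steps of positive
probability. -/
def Reaches (P : X → PMF X) : X → X → Prop :=
  Relation.ReflTransGen fun x y => P x y ≠ 0

/-- A recurrent class: a communicating class all of whose states are recurrent. -/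
def IsRecurrentClass (P : X → PMF X) (R : Finset X) : Prop :=
  (∃ x, ∀ y, y ∈ R ↔ Reaches P x y ∧ Reaches P y x) ∧ ∀ y ∈ R, IsRecurrentState P y

open Classical in
/-- The finite set `{R₁, …, R_L}` of all recurrent classes. -/
def recurrentClasses (P : X → PMF X) : Finset (Finset X) :=
  Finset.univ.filter (IsRecurrentClass P)

/-- `μ` is a stationary distribution of the chain that is carried by `R`. -/
def IsStationaryOn (P : X → PMF X) (R : Finset X) (μ : PMF X) : Prop :=
  μ.bind P = μ ∧ ∀ x, x ∉ R → μ x = 0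

/-- `ℙ(S_t ∈ R)` for the chain with initial distribution `ν`. -/
def probIn (ν : PMF X) (P : X → PMF X) (R : Finset X) (t : ℕ) : ℝ :=
  (markovLaw ν P).real {ω | ω t ∈ R}

/-- The absorption probability `lim_{t → ∞} ℙ(S_t ∈ R)`. -/
def absorptionProb (ν : PMF X) (P : X → PMF X) (R : Finset X) : ℝ :=
  limUnder atTop (probIn ν P R)

end MarkovChain

/-! ### General-utility Markov decision processes -/

/-- The set of probability vectors over `X`, as a subset of Euclidean space. -/
def probSimplex (X : Type*) [Fintype X] : Set (EuclideanSpace ℝ X) :=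
  {d | (fun x => d x) ∈ stdSimplex ℝ X}

/-- A general-utility Markov decision process with state space `S` and action space `A`.
Only the values of `utility` on the simplex `probSimplex (S × A)` are meaningful. -/
structure GUMDP (S A : Type*) [Fintype S] [Fintype A] where
  /-- `trans s a s'` is the probability of moving to `s'` after playing `a` in `s`. -/
  trans : S → A → PMF S
  /-- The distribution of the initial state. -/
  init : PMF S
  /-- The objective `f`, a function of a state-action occupancy. -/
  utility : EuclideanSpace ℝ (S × A) → ℝ

section Empirical

variable {X : Type*}

/-- `(1 / H) ∑_{t < H} 1(τ_t = x)`. -/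
def empFreq (τ : ℕ → X) (x : X) (H : ℕ) : ℝ :=
  (1 / (H : ℝ)) * ∑ t ∈ Finset.range H, Set.indicator {x} (fun _ => (1 : ℝ)) (τ t)

/-- The empirical average occupancy of one infinite trajectory. -/
def empOcc (τ : ℕ → X) (x : X) : ℝ :=
  limUnder atTop (empFreq τ x)

/-- The empirical average occupancy of `K` infinite trajectories. -/
def empOccTrials [Fintype X] {K : ℕ} (T : Fin K → ℕ → X) : EuclideanSpace ℝ X :=
  WithLp.toLp 2 fun x => (1 / (K : ℝ)) * ∑ k, empOcc (T k) x

end Empirical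

namespace GUMDP

variable {S A : Type*} [Fintype S] [Fintype A]

/-- The transition matrix `P^π(s, s') = ∑ a, π(a|s) p(s'|s, a)` of the stationary policy `π`. -/
def policyKernel (M : GUMDP S A) (π : S → PMF A) (s : S) : PMF S :=
  (π s).bind (M.trans s)

/-- The distribution of `(s, a)` when `s` has distribution `ν` and `a` is drawn from `π(·|s)`. -/
def withAction (π : S → PMF A) (ν : PMF S) : PMF (S × A) :=
  ν.bind fun s => (π s).map fun a => (s, a)

variable [MeasurableSpace S] [MeasurableSingletonClass S]
  [MeasurableSpace A] [MeasurableSingletonClass A]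

/-- The law `ζ_π` of the trajectory `(S₀, A₀), (S₁, A₁), …` under the stationary policy `π`:
`S₀` has law `init`, `A_t` has law `π(·|S_t)` and `S_{t+1}` has law `trans S_t A_t`. -/
def trajLaw (M : GUMDP S A) (π : S → PMF A) : Measure (ℕ → S × A) :=
  markovLaw (withAction π M.init) fun x => withAction π (M.trans x.1 x.2)

/-- The law of `K` independent trajectories. -/
def trialsLaw (M : GUMDP S A) (π : S → PMF A) (K : ℕ) : Measure (Fin K → ℕ → S × A) :=
  Measure.pi fun _ => M.trajLaw π

/-- `(1 / H) ∑_{t < H} ℙ((S_t, A_t) = x)`. -/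
def expFreq (M : GUMDP S A) (π : S → PMF A) (x : S × A) (H : ℕ) : ℝ :=
  (1 / (H : ℝ)) * ∑ t ∈ Finset.range H, (M.trajLaw π).real {τ | τ t = x}

/-- The average state-action occupancy `d_π`. -/
def avgOcc (M : GUMDP S A) (π : S → PMF A) : EuclideanSpace ℝ (S × A) :=
  WithLp.toLp 2 fun x => limUnder atTop (M.expFreq π x)

/-- The infinite trials objective `f_∞(π) = f(d_π)`. -/
def infiniteTrials (M : GUMDP S A) (π : S → PMF A) : ℝ :=
  M.utility (M.avgOcc π)

/-- The finite trials objective `f_K(π)`, the expectation of `f` at the empirical average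
occupancy of `K` independent trajectories. -/
def finiteTrials (M : GUMDP S A) (π : S → PMF A) (K : ℕ) : ℝ :=
  ∫ T, M.utility (empOccTrials T) ∂(M.trialsLaw π K)

end GUMDP

/-- The first-order inequality for strong convexity, with an arbitrary vector in the role of the
gradient, implies `StrongConvexOn`, which needs no differentiability. -/
theorem strongConvexOn_of_firstOrder {E : Type*} [NormedAddCommGroup E] [InnerProductSpace ℝ E]
    {s : Set E} (hs : Convex ℝ s) {c : ℝ} {f : E → ℝ} (g : E → E)
    (h : ∀ x ∈ s, ∀ y ∈ s, f y + inner ℝ (g y) (x - y) + c / 2 * ‖x - y‖ ^ 2 ≤ f x) :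
    StrongConvexOn s c f := by
  refine ⟨hs, fun x hx y hy a b ha hb hab => ?_⟩
  have hz : a • x + b • y ∈ s := hs hx hy ha hb hab
  have h1 := h x hx _ hz
  have h2 := h y hy _ hz
  obtain rfl : a = 1 - b := by linarith
  have e1 : x - ((1 - b) • x + b • y) = b • (x - y) := by module
  have e2 : y - ((1 - b) • x + b • y) = (-(1 - b)) • (x - y) := by module
  rw [e1, inner_smul_right, norm_smul, mul_pow, Real.norm_eq_abs, sq_abs] at h1
  rw [e2, inner_smul_right, norm_smul, mul_pow, Real.norm_eq_abs, sq_abs] at h2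
  have h3 := mul_le_mul_of_nonneg_left h1 ha
  have h4 := mul_le_mul_of_nonneg_left h2 hb
  simp only [smul_eq_mul]
  linear_combination h3 + h4

end

/-! Strong convexity says that `f - c/2 ‖·‖²` is convex on the simplex. Jensen's inequality for this
function, applied to the random occupancy `D` of the `K` trajectories, gives `𝔼 f(D) - f(𝔼 D) ≥ c/2
∑ z, Var D(z)` (`StrongConvexOn.variance_le_jensen_gap`). Here `𝔼 D = d_π` by dominated convergence,
and independence gives `Var D(z) = (1/K) Var (empOcc · z)`, so the variances for a single trajectory
remain to be bounded below.

If `s` lies in a recurrent class `R` and `π(a|s) > 0`, the occupancy of `(s, a)` is almost surely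
`π(a|s) μ(s)` on the trajectories that enter `R` and zero on the others. It is a multiple of a
Bernoulli variable with parameter the absorption probability `α`, with variance `α (1 - α) π(a|s)²
μ(s)²` (`variance_empOcc`). Recurrent classes are disjoint, so summing these variances and dropping
the other nonnegative ones gives the bound.

The almost sure limits come from linear algebra and martingales. For the transition operator `P`,
every `g` splits as `g = h + (P v - v)` with `P h = h`. Along a path, `h` is a bounded martingale
and converges; the coboundary is a telescoping term minus martingale increments, and both average to
zero. Hence the averages of `g` converge to the limit of `h` (`ae_tendsto_average`). On a closed
communicating class `h` is constant, and the stationary distribution identifies the constant. Since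
`h` takes finitely many values, `D` is almost surely finitely valued, so the utility needs no
measurability. Trajectories live on state-action pairs while classes live on states;
`pmfMean_transOp_pairKernel` passes between the two chains. -/

noncomputable section

/-! ### Means and the transition operator -/

section TransitionOperator

variable {X Y : Type*} [Fintype X] [Fintype Y]

/-- The mean of `g` under `p`. -/
def pmfMean (p : PMF X) (g : X → ℝ) : ℝ := ∑ x, (p x).toReal * g x

lemma PMF.sum_toReal (p : PMF X) : ∑ x, (p x).toReal = 1 := by
  rw [← ENNReal.toReal_sum fun x _ => p.apply_ne_top x, ← tsum_fintype (L := .unconditional _),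
    p.tsum_coe, ENNReal.toReal_one]

lemma PMF.toReal_apply_ne_zero {Z : Type*} (p : PMF Z) (z : Z) : (p z).toReal ≠ 0 ↔ p z ≠ 0 := by
  simp [ENNReal.toReal_eq_zero_iff, p.apply_ne_top z]

lemma pmfMean_const (p : PMF X) (b : ℝ) : pmfMean p (fun _ => b) = b := by
  rw [pmfMean, ← Finset.sum_mul, p.sum_toReal, one_mul]

lemma pmfMean_congr {p : PMF X} {g g' : X → ℝ} (h : ∀ x, p x ≠ 0 → g x = g' x) :
    pmfMean p g = pmfMean p g' := by
  refine Finset.sum_congr rfl fun x _ => ?_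
  by_cases hx : p x = 0
  · simp [hx]
  · rw [h x hx]

lemma pmfMean_mono {p : PMF X} {g g' : X → ℝ} (h : ∀ x, g x ≤ g' x) :
    pmfMean p g ≤ pmfMean p g' :=
  Finset.sum_le_sum fun x _ => mul_le_mul_of_nonneg_left (h x) ENNReal.toReal_nonneg

lemma abs_pmfMean_le {p : PMF X} {g : X → ℝ} {b : ℝ} (h : ∀ x, |g x| ≤ b) :
    |pmfMean p g| ≤ b := by
  rw [abs_le]
  constructor
  · rw [← pmfMean_const p (-b)]
    exact pmfMean_mono fun x => (abs_le.1 (h x)).1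
  · rw [← pmfMean_const p b]
    exact pmfMean_mono fun x => (abs_le.1 (h x)).2

lemma pmfMean_indicator (p : PMF X) (y : X) :
    pmfMean p (Set.indicator {y} fun _ => (1 : ℝ)) = (p y).toReal := by
  classical
  simp [pmfMean, Set.indicator_apply]

lemma pmfMean_bind (p : PMF X) (q : X → PMF Y) (g : Y → ℝ) :
    pmfMean (p.bind q) g = pmfMean p fun x => pmfMean (q x) g := by
  have h : ∀ y, ((p.bind q) y).toReal = ∑ x, (p x).toReal * (q x y).toReal := fun y => by
    rw [PMF.bind_apply, tsum_fintype, ENNReal.toReal_sum fun x _ =>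
      ENNReal.mul_ne_top (p.apply_ne_top x) ((q x).apply_ne_top y)]
    simp only [ENNReal.toReal_mul]
  simp only [pmfMean, h, Finset.sum_mul, Finset.mul_sum]
  rw [Finset.sum_comm]
  simp only [mul_assoc]

lemma pmfMean_pure (x : X) (g : X → ℝ) : pmfMean (PMF.pure x) g = g x := by
  classical
  simp [pmfMean, PMF.pure_apply, apply_ite ENNReal.toReal]

lemma pmfMean_map (p : PMF X) (φ : X → Y) (g : Y → ℝ) :
    pmfMean (p.map φ) g = pmfMean p fun x => g (φ x) := by
  rw [PMF.map, pmfMean_bind]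
  simp only [Function.comp_apply, pmfMean_pure]

lemma PMF.ext_of_pmfMean {p q : PMF X}
    (h : ∀ y, pmfMean p (Set.indicator {y} fun _ => (1 : ℝ)) =
      pmfMean q (Set.indicator {y} fun _ => (1 : ℝ))) : p = q := by
  ext y
  have := h y
  rwa [pmfMean_indicator, pmfMean_indicator,
    ENNReal.toReal_eq_toReal_iff' (p.apply_ne_top y) (q.apply_ne_top y)] at this

/-- The transition operator `g ↦ (x ↦ 𝔼[g(X₁) | X₀ = x])`. -/
def transOp (P : X → PMF X) : (X → ℝ) →ₗ[ℝ] (X → ℝ) where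
  toFun g x := pmfMean (P x) g
  map_add' g g' := by
    ext x
    simp [pmfMean, mul_add, Finset.sum_add_distrib]
  map_smul' b g := by
    ext x
    simp [pmfMean, Finset.mul_sum, mul_left_comm]

lemma transOp_apply (P : X → PMF X) (g : X → ℝ) (x : X) :
    transOp P g x = pmfMean (P x) g := rfl

lemma abs_transOp_pow_le (P : X → PMF X) {g : X → ℝ} {b : ℝ} (h : ∀ x, |g x| ≤ b) (n : ℕ) :
    ∀ x, |(transOp P ^ n) g x| ≤ b := by
  induction n with
  | zero => simpa using h
  | succ n ih =>
    intro x
    rw [pow_succ', Module.End.mul_apply, transOp_apply]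
    exact abs_pmfMean_le ih

lemma exists_abs_le (g : X → ℝ) : ∃ b, ∀ x, |g x| ≤ b :=
  ⟨∑ x, |g x|, fun x => Finset.single_le_sum (f := fun x => |g x|)
    (fun _ _ => abs_nonneg _) (Finset.mem_univ x)⟩

/-- Harmonic functions are fixed by every iterate, and the coboundary telescopes. -/
lemma transOp_pow_of_coboundary (P : X → PMF X) {h v : X → ℝ} (hh : transOp P h = h) (n : ℕ) :
    (∑ t ∈ Finset.range n, (transOp P ^ t) (h + (transOp P v - v))) =
      (n : ℝ) • h + ((transOp P ^ n) v - v) := by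
  have hpow : ∀ t, (transOp P ^ t) h = h := fun t => by
    induction t with
    | zero => rfl
    | succ t ih => rw [pow_succ, Module.End.mul_apply, hh, ih]
  induction n with
  | zero => simp
  | succ n ih =>
    rw [Finset.sum_range_succ, ih, map_add, map_sub, hpow, ← Module.End.mul_apply, ← pow_succ]
    push_cast
    module

lemma disjoint_ker_range_transOp (P : X → PMF X) :
    Disjoint (transOp P - 1).ker (transOp P - 1).range := by
  rw [Submodule.disjoint_def]
  rintro u hu ⟨v, rfl⟩
  set u := (transOp P - 1) v with hudef
  have hu' : transOp P u = u := sub_eq_zero.1 hu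
  obtain ⟨b, hb⟩ := exists_abs_le v
  ext x
  -- For `u = P v - v` fixed by `P`, telescoping gives `n u = P^n v - v`, which is bounded in `n`;
  -- this forces `u = 0`.
  have key : ∀ n : ℕ, (n : ℝ) * |u x| ≤ 2 * b := fun n => by
    have h1 := congrFun (transOp_pow_of_coboundary P (v := v) (map_zero (transOp P)) n) x
    have hpow : ∀ t, (transOp P ^ t) u = u := fun t => by
      induction t with
      | zero => rfl
      | succ t ih => rw [pow_succ, Module.End.mul_apply, hu', ih]
    have h2 : (0 : X → ℝ) + (transOp P v - v) = u := by rw [zero_add]; rfl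
    simp only [h2, hpow, Finset.sum_const, Finset.card_range, smul_zero, zero_add, Pi.sub_apply,
      Pi.smul_apply, nsmul_eq_mul] at h1
    have h3 : |(n : ℝ) * u x| ≤ 2 * b := by
      rw [h1]
      have := abs_transOp_pow_le P hb n x
      have := hb x
      have := abs_sub ((transOp P ^ n) v x) (v x)
      linarith
    rwa [abs_mul, Nat.abs_cast] at h3
  by_contra hne
  have hpos : 0 < |u x| := abs_pos.2 hne
  obtain ⟨n, hn⟩ := exists_nat_gt (2 * b / |u x|)
  rw [div_lt_iff₀ hpos] at hn
  exact absurd (key n) (not_le.2 hn)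

lemma isCompl_ker_range_transOp (P : X → PMF X) :
    IsCompl (transOp P - 1).ker (transOp P - 1).range := by
  rw [Submodule.isCompl_iff_disjoint]
  · exact disjoint_ker_range_transOp P
  · rw [add_comm, LinearMap.finrank_range_add_finrank_ker]

/-- The projection onto the harmonic functions along the coboundaries. -/
def harmonicProj (P : X → PMF X) : (X → ℝ) →ₗ[ℝ] (X → ℝ) :=
  Submodule.projection _ _ (isCompl_ker_range_transOp P)

lemma transOp_harmonicProj (P : X → PMF X) (g : X → ℝ) :
    transOp P (harmonicProj P g) = harmonicProj P g :=
  sub_eq_zero.1 (Submodule.projection_apply_mem (isCompl_ker_range_transOp P) g)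

lemma exists_eq_harmonicProj_add (P : X → PMF X) (g : X → ℝ) :
    ∃ v, g = harmonicProj P g + (transOp P v - v) := by
  obtain ⟨v, hv⟩ := Submodule.projection_apply_mem (isCompl_ker_range_transOp P).symm g
  exact ⟨v, by
    conv_lhs => rw [← Submodule.projection_add_projection_eq_self (isCompl_ker_range_transOp P) g,
      ← hv]
    rfl⟩

lemma harmonicProj_transOp (P : X → PMF X) (g : X → ℝ) :
    harmonicProj P (transOp P g) = harmonicProj P g := by
  rw [← sub_eq_zero, ← map_sub, harmonicProj, Submodule.projection_apply_eq_zero_iff]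
  exact ⟨g, rfl⟩

lemma harmonicProj_of_harmonic {P : X → PMF X} {g : X → ℝ} (h : transOp P g = g) :
    harmonicProj P g = g :=
  Submodule.projection_apply_of_mem_left _ (sub_eq_zero.2 h)

/-- The Cesàro averages of the iterates of the transition operator converge to the projection. -/
lemma tendsto_cesaro_transOp (P : X → PMF X) (g : X → ℝ) (x : X) :
    Tendsto (fun n : ℕ => (n : ℝ)⁻¹ * ∑ t ∈ Finset.range n, (transOp P ^ t) g x) atTop
      (𝓝 (harmonicProj P g x)) := by
  obtain ⟨v, hv⟩ := exists_eq_harmonicProj_add P g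
  obtain ⟨b, hb⟩ := exists_abs_le v
  have h1 : ∀ n : ℕ, ∑ t ∈ Finset.range n, (transOp P ^ t) g x =
      n * harmonicProj P g x + ((transOp P ^ n) v x - v x) := fun n => by
    have := congrFun (transOp_pow_of_coboundary P (v := v) (transOp_harmonicProj P g) n) x
    rw [← hv] at this
    simpa using this
  have h2 : Tendsto (fun n : ℕ => (n : ℝ)⁻¹ * ((transOp P ^ n) v x - v x)) atTop (𝓝 0) := by
    refine (tendsto_inv_atTop_nhds_zero_nat (𝕜 := ℝ)).zero_mul_isBoundedUnder_le ?_
    refine isBoundedUnder_of ⟨b + b, fun n => ?_⟩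
    have := abs_transOp_pow_le P hb n x
    have := hb x
    have := abs_sub ((transOp P ^ n) v x) (v x)
    simp only [Function.comp_apply, Real.norm_eq_abs]
    linarith
  have h3 := h2.const_add (harmonicProj P g x)
  rw [add_zero] at h3
  refine h3.congr' ?_
  filter_upwards [eventually_gt_atTop 0] with n hn
  have : (n : ℝ) ≠ 0 := by positivity
  rw [h1, mul_add, inv_mul_cancel_left₀ this]

lemma harmonicProj_nonneg (P : X → PMF X) {g : X → ℝ} (hg : ∀ x, 0 ≤ g x) (x : X) :
    0 ≤ harmonicProj P g x := by
  have hpow : ∀ t x, 0 ≤ (transOp P ^ t) g x := fun t => by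
    induction t with
    | zero => simpa using hg
    | succ t ih =>
      intro x
      rw [pow_succ', Module.End.mul_apply, transOp_apply]
      exact Finset.sum_nonneg fun y _ => mul_nonneg ENNReal.toReal_nonneg (ih y)
  exact ge_of_tendsto' (tendsto_cesaro_transOp P g x) fun n =>
    mul_nonneg (by positivity) (Finset.sum_nonneg fun t _ => hpow t x)

/-- No transition of positive probability leaves `C`. -/
def IsClosedUnder (P : X → PMF X) (C : Set X) : Prop :=
  ∀ x ∈ C, ∀ y, P x y ≠ 0 → y ∈ C

/-- On a closed set, the iterates of `P` see only the values of `g` inside the set. -/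
lemma harmonicProj_eq_zero_of_isClosedUnder {P : X → PMF X} {C : Set X} (hC : IsClosedUnder P C)
    {g : X → ℝ} (hg : ∀ x ∈ C, g x = 0) {x : X} (hx : x ∈ C) : harmonicProj P g x = 0 := by
  have hpow : ∀ t, ∀ x ∈ C, (transOp P ^ t) g x = 0 := fun t => by
    induction t with
    | zero => simpa using hg
    | succ t ih =>
      intro x hx
      rw [pow_succ', Module.End.mul_apply, transOp_apply, ← pmfMean_const (P x) 0]
      exact pmfMean_congr fun y hy => ih y (hC x hx y hy)
  refine tendsto_nhds_unique (tendsto_cesaro_transOp P g x) ?_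
  simp only [hpow _ x hx, Finset.sum_const_zero, mul_zero]
  exact tendsto_const_nhds

lemma pmfMean_transOp_of_stationary {P : X → PMF X} {μ : PMF X} (hμ : μ.bind P = μ) (g : X → ℝ) :
    pmfMean μ (transOp P g) = pmfMean μ g := by
  conv_rhs => rw [← hμ, pmfMean_bind]
  rfl

/-- A stationary mean annihilates the coboundary `P v - v`. -/
lemma pmfMean_harmonicProj_of_stationary {P : X → PMF X} {μ : PMF X} (hμ : μ.bind P = μ)
    (g : X → ℝ) : pmfMean μ (harmonicProj P g) = pmfMean μ g := by
  obtain ⟨v, hv⟩ := exists_eq_harmonicProj_add P g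
  have hadd : ∀ g₁ g₂ : X → ℝ, pmfMean μ (g₁ + g₂) = pmfMean μ g₁ + pmfMean μ g₂ := fun g₁ g₂ => by
    simp [pmfMean, mul_add, Finset.sum_add_distrib]
  have h1 := hadd (transOp P v - v) v
  rw [sub_add_cancel, pmfMean_transOp_of_stationary hμ] at h1
  have h2 := hadd (harmonicProj P g) (transOp P v - v)
  rw [← hv] at h2
  linarith

lemma pmfMean_eq_of_stationary {P : X → PMF X} {μ : PMF X} (hμ : μ.bind P = μ) {C : Set X}
    (hC : ∀ x, μ x ≠ 0 → x ∈ C) {g : X → ℝ} {b : ℝ} (hb : ∀ x ∈ C, harmonicProj P g x = b) :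
    pmfMean μ g = b := by
  rw [← pmfMean_harmonicProj_of_stationary hμ, ← pmfMean_const μ b]
  exact pmfMean_congr fun x hx => hb x (hC x hx)

/-- Harmonic functions are constant on a finite closed communicating class. -/
lemma harmonic_eq_of_isClosedUnder {P : X → PMF X} {R : Finset X}
    (hC : IsClosedUnder P R) (hR : ∀ x ∈ R, ∀ y ∈ R, Reaches P x y) {h : X → ℝ}
    (hh : ∀ x ∈ R, pmfMean (P x) h = h x) {x y : X} (hx : x ∈ R) (hy : y ∈ R) : h x = h y := by
  -- Maximum principle: at a maximum point, harmonicity forces every successor to be a maximum point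
  -- too, and every point of `R` is reachable from `z`.
  obtain ⟨z, hz, hmax⟩ := R.exists_max_image h ⟨x, hx⟩
  have key : ∀ w, Reaches P z w → w ∈ R ∧ h w = h z := fun w hw => by
    induction hw with
    | refl => exact ⟨hz, rfl⟩
    | @tail u w _ huw ih =>
      obtain ⟨huR, hu⟩ := ih
      have hwR : w ∈ R := hC u huR w huw
      refine ⟨hwR, le_antisymm (hmax w hwR) (not_lt.1 fun hlt => ?_)⟩
      have hlt' : pmfMean (P u) h < pmfMean (P u) fun _ => h z := by
        refine Finset.sum_lt_sum (fun v _ => ?_) ⟨w, Finset.mem_univ w, ?_⟩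
        · by_cases hv : P u v = 0
          · simp [hv]
          · exact mul_le_mul_of_nonneg_left (hmax v (hC u huR v hv)) ENNReal.toReal_nonneg
        · exact mul_lt_mul_of_pos_left hlt
            (ENNReal.toReal_pos huw ((P u).apply_ne_top w))
      rw [pmfMean_const, hh u huR, hu] at hlt'
      exact lt_irrefl _ hlt'
  rw [(key x (hR z hz x hx)).2, (key y (hR z hz y hy)).2]

lemma harmonicProj_sum (P : X → PMF X) (g : X → ℝ) (x : X) :
    harmonicProj P g x =
      ∑ y, harmonicProj P (Set.indicator {y} fun _ => (1 : ℝ)) x * g y := by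
  classical
  have : g = ∑ y, g y • Set.indicator {y} fun _ => (1 : ℝ) := by
    ext z
    simp [Finset.sum_apply, Pi.single_apply]
  conv_lhs => rw [this]
  simp only [map_sum, map_smul, Finset.sum_apply, Pi.smul_apply, smul_eq_mul, mul_comm]

/-- The stationary distribution reached in Cesàro mean from `x`. -/
def cesaroPMF (P : X → PMF X) (x : X) : PMF X :=
  PMF.ofFintype
    (fun y => ENNReal.ofReal (harmonicProj P (Set.indicator {y} fun _ => (1 : ℝ)) x)) (by
      rw [← ENNReal.ofReal_sum_of_nonneg fun y _ =>
        harmonicProj_nonneg P (fun z => Set.indicator_nonneg (fun _ _ => zero_le_one) z) x]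
      -- Constants are harmonic, so each row of the projection has total mass one.
      have h1 : transOp P (fun _ => 1) = fun _ => 1 := funext fun x => pmfMean_const (P x) 1
      have h := harmonicProj_sum P (fun _ => 1) x
      rw [harmonicProj_of_harmonic h1] at h
      simp only [mul_one] at h
      rw [← h, ENNReal.ofReal_one])

lemma pmfMean_cesaroPMF (P : X → PMF X) (x : X) (g : X → ℝ) :
    pmfMean (cesaroPMF P x) g = harmonicProj P g x := by
  rw [harmonicProj_sum]
  refine Finset.sum_congr rfl fun y _ => ?_
  rw [cesaroPMF, PMF.ofFintype_apply, ENNReal.toReal_ofReal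
    (harmonicProj_nonneg P (fun z => Set.indicator_nonneg (fun _ _ => zero_le_one) z) x)]

lemma cesaroPMF_stationary (P : X → PMF X) (x : X) :
    (cesaroPMF P x).bind P = cesaroPMF P x := by
  refine PMF.ext_of_pmfMean fun y => ?_
  rw [pmfMean_bind, pmfMean_cesaroPMF, pmfMean_cesaroPMF]
  exact congrFun (harmonicProj_transOp P _) x

/-- A closed communicating class carries exactly one stationary distribution. -/
lemma existsUnique_isStationaryOn {P : X → PMF X} {R : Finset X} (hne : R.Nonempty)
    (hC : IsClosedUnder P R) (hR : ∀ x ∈ R, ∀ y ∈ R, Reaches P x y) :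
    ∃! μ : PMF X, IsStationaryOn P R μ := by
  obtain ⟨x, hx⟩ := hne
  refine ⟨cesaroPMF P x, ⟨cesaroPMF_stationary P x, fun y hy => ?_⟩, fun μ hμ => ?_⟩
  · refine ((ENNReal.toReal_eq_zero_iff _).1 ?_).resolve_right ((cesaroPMF P x).apply_ne_top y)
    rw [← pmfMean_indicator, pmfMean_cesaroPMF]
    refine harmonicProj_eq_zero_of_isClosedUnder hC (fun z hz => ?_) hx
    exact Set.indicator_of_notMem (by rintro rfl; exact hy hz) _
  · refine PMF.ext_of_pmfMean fun y => ?_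
    rw [pmfMean_cesaroPMF]
    -- Uniqueness: projected indicators are constant on `R`, so every stationary distribution
    -- carried by `R` gives `y` the same mass.
    refine pmfMean_eq_of_stationary hμ.1 (C := R) (fun z hz => ?_) fun z hz => ?_
    · exact not_imp_comm.1 (hμ.2 z) hz
    · exact harmonic_eq_of_isClosedUnder hC hR
        (fun w _ => congrFun (transOp_harmonicProj P _) w) hz hx

end TransitionOperator

/-! ### Path measures of finite Markov chains -/

/-! ### Martingale increments of a function along a path -/

section CompensatedSum

variable {X : Type*} [Fintype X]

/-- The weighted sums of the compensated increments of `v` along a path. -/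
def compensatedSum (P : X → PMF X) (v : X → ℝ) (w : ℕ → ℝ) (n : ℕ) (ω : ℕ → X) : ℝ :=
  ∑ k ∈ Finset.range n, w k * (v (ω (k + 1)) - transOp P v (ω k))

lemma dependsOn_compensatedSum (P : X → PMF X) (v : X → ℝ) (w : ℕ → ℝ) (n : ℕ) :
    DependsOn (compensatedSum P v w n) (Set.Iic n) := fun ω ω' h =>
  Finset.sum_congr rfl fun k hk => by
    have hk := Finset.mem_range.1 hk
    rw [h k (Set.mem_Iic.2 hk.le), h (k + 1) (Set.mem_Iic.2 hk)]

lemma pmfMean_compensated (P : X → PMF X) (v : X → ℝ) (x : X) :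
    pmfMean (P x) (fun y => v y - transOp P v x) = 0 := by
  simp only [pmfMean, mul_sub, Finset.sum_sub_distrib, ← Finset.sum_mul, (P x).sum_toReal, one_mul]
  exact sub_self _

end CompensatedSum

/-! ### Markov property, martingale convergence and the ergodic theorem -/

section PathMeasure

lemma DependsOn.exists_eq_frestrictLe {X : Type*} {Φ : (ℕ → X) → ℝ} {n : ℕ}
    (hΦ : DependsOn Φ (Set.Iic n)) :
    ∃ F : (Finset.Iic n → X) → ℝ, ∀ ω, Φ ω = F (Preorder.frestrictLe n ω) := by
  -- Coordinates beyond `n` are filled with the value at time `n`, an arbitrary choice that `Φ`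
  -- ignores.
  refine ⟨fun h => Φ fun k => if hk : k ∈ Finset.Iic n then h ⟨k, hk⟩ else
    h ⟨n, Finset.mem_Iic.2 le_rfl⟩, fun ω => hΦ fun k hk => ?_⟩
  rw [dif_pos (Finset.mem_Iic.2 hk)]
  rfl

variable {X : Type*} [Fintype X] [MeasurableSpace X] [MeasurableSingletonClass X]

instance markovLaw.instIsProbabilityMeasure (ν : PMF X) (P : X → PMF X) :
    IsProbabilityMeasure (markovLaw ν P) := by
  unfold markovLaw
  infer_instance

lemma integrable_comp_of_finite {Ω Y : Type*} [MeasurableSpace Ω] {μ : Measure Ω}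
    [IsFiniteMeasure μ] [Finite Y] [MeasurableSpace Y] [MeasurableSingletonClass Y] {Z : Ω → Y}
    (hZ : Measurable Z) (g : Y → ℝ) : Integrable (fun ω => g (Z ω)) μ :=
  Integrable.of_finite.comp_measurable hZ

lemma integral_toMeasure_eq_pmfMean (p : PMF X) (g : X → ℝ) :
    ∫ x, g x ∂p.toMeasure = pmfMean p g := by
  simp [PMF.integral_eq_sum, pmfMean]

lemma integral_markovLaw_frestrictLe_succ (ν : PMF X) (P : X → PMF X) (n : ℕ)
    (φ : (Finset.Iic n → X) → X → ℝ) :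
    ∫ ω, φ (Preorder.frestrictLe n ω) (ω (n + 1)) ∂(markovLaw ν P) =
      ∫ ω, pmfMean (P (ω n)) (φ (Preorder.frestrictLe n ω)) ∂(markovLaw ν P) := by
  have h := Kernel.map_frestrictLe_trajMeasure_compProd_eq_map_trajMeasure
    (X := fun _ => X) (μ₀ := ν.toMeasure) (κ := markovStep P) (a := n)
  have h1 : ∫ ω, φ (Preorder.frestrictLe n ω) (ω (n + 1)) ∂(markovLaw ν P) =
      ∫ z, φ z.1 z.2 ∂((markovLaw ν P).map
        fun ω => ((Preorder.frestrictLe n ω : Finset.Iic n → X), ω (n + 1))) := by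
    rw [integral_map (by fun_prop) (measurable_of_finite _).aestronglyMeasurable]
  rw [h1, markovLaw, ← h, Measure.integral_compProd Integrable.of_finite,
    integral_map (by fun_prop) (measurable_of_finite _).aestronglyMeasurable]
  refine integral_congr_ae (Eventually.of_forall fun ω => ?_)
  exact integral_toMeasure_eq_pmfMean _ _

lemma DependsOn.integrable_markovLaw {Φ : (ℕ → X) → ℝ} {n : ℕ} (hΦ : DependsOn Φ (Set.Iic n))
    (ν : PMF X) (P : X → PMF X) : Integrable Φ (markovLaw ν P) := by
  obtain ⟨F, hF⟩ := hΦ.exists_eq_frestrictLe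
  rw [funext hF]
  exact integrable_comp_of_finite (by fun_prop) F

lemma DependsOn.stronglyMeasurable_piLE {Φ : (ℕ → X) → ℝ} {n : ℕ}
    (hΦ : DependsOn Φ (Set.Iic n)) :
    StronglyMeasurable[Filtration.piLE (X := fun _ : ℕ => X) n] Φ := by
  obtain ⟨F, hF⟩ := hΦ.exists_eq_frestrictLe
  rw [funext hF, Filtration.piLE_eq_comap_frestrictLe]
  exact ((measurable_of_finite F).comp (comap_measurable _)).stronglyMeasurable

/-- The Markov property, integrated against a function of the past. -/
lemma integral_mul_markovLaw_succ (ν : PMF X) (P : X → PMF X) {n : ℕ} {Φ : (ℕ → X) → ℝ}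
    (hΦ : DependsOn Φ (Set.Iic n)) (φ : X → X → ℝ) :
    ∫ ω, Φ ω * φ (ω n) (ω (n + 1)) ∂(markovLaw ν P) =
      ∫ ω, Φ ω * pmfMean (P (ω n)) (φ (ω n)) ∂(markovLaw ν P) := by
  obtain ⟨F, hF⟩ := hΦ.exists_eq_frestrictLe
  have h := integral_markovLaw_frestrictLe_succ ν P n
    fun h y => F h * φ (h ⟨n, Finset.mem_Iic.2 le_rfl⟩) y
  simp only [hF]
  refine h.trans (integral_congr_ae (Eventually.of_forall fun ω => ?_))
  simp only [pmfMean, Finset.mul_sum, mul_left_comm]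
  rfl

lemma integral_markovLaw_succ (ν : PMF X) (P : X → PMF X) (n : ℕ) (g : X → ℝ) :
    ∫ ω, g (ω (n + 1)) ∂(markovLaw ν P) = ∫ ω, transOp P g (ω n) ∂(markovLaw ν P) := by
  have h := integral_mul_markovLaw_succ ν P (n := n) (dependsOn_const (1 : ℝ)|>.mono (by simp))
    (fun _ => g)
  simpa only [one_mul] using! h

lemma integral_markovLaw_zero (ν : PMF X) (P : X → PMF X) (g : X → ℝ) :
    ∫ ω, g (ω 0) ∂(markovLaw ν P) = pmfMean ν g := by
  rw [← integral_toMeasure_eq_pmfMean]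
  have h : (markovLaw ν P).map (fun ω => ω 0) = ν.toMeasure := by
    have h0 : (markovLaw ν P).map (Preorder.frestrictLe 0) =
        ν.toMeasure.map (MeasurableEquiv.piUnique fun _ : Finset.Iic 0 => X).symm := by
      rw [markovLaw, Kernel.trajMeasure, Measure.map_comp _ _ (by fun_prop),
        Kernel.traj_map_frestrictLe, Kernel.partialTraj_self, Measure.id_comp]
    have h1 := congrArg (Measure.map (MeasurableEquiv.piUnique fun _ : Finset.Iic 0 => X)) h0
    rw [MeasurableEquiv.map_map_symm, Measure.map_map (by fun_prop) (by fun_prop)] at h1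
    exact h1
  rw [← h, integral_map (measurable_pi_apply 0).aemeasurable
    (measurable_of_finite _).aestronglyMeasurable]

/-- Almost every path only uses transitions of positive probability. -/
lemma ae_transition_ne_zero (ν : PMF X) (P : X → PMF X) :
    ∀ᵐ ω ∂(markovLaw ν P), ∀ n, P (ω n) (ω (n + 1)) ≠ 0 := by
  classical
  rw [ae_all_iff]
  intro n
  have h := integral_mul_markovLaw_succ ν P (n := n) (dependsOn_const (1 : ℝ)|>.mono (by simp))
    (fun x y => if P x y = 0 then 1 else 0)
  have h0 : ∀ x, pmfMean (P x) (fun y => if P x y = 0 then 1 else 0) = 0 := fun x =>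
    Finset.sum_eq_zero fun y _ => by by_cases hy : P x y = 0 <;> simp [hy]
  simp only [h0, mul_zero, integral_zero, one_mul] at h
  rw [integral_eq_zero_iff_of_nonneg (fun ω => by dsimp; split_ifs <;> simp)
    (integrable_comp_of_finite (Z := fun ω : ℕ → X => (ω n, ω (n + 1))) (by fun_prop)
      fun z => if P z.1 z.2 = 0 then 1 else 0)] at h
  filter_upwards [h] with ω hω h'
  simp [h'] at hω

/-- Almost every path that enters a closed set stays there. -/
lemma ae_mem_of_isClosedUnder (ν : PMF X) {P : X → PMF X} {C : Set X} (hC : IsClosedUnder P C) :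
    ∀ᵐ ω ∂(markovLaw ν P), ∀ n, ω n ∈ C → ∀ m, n ≤ m → ω m ∈ C := by
  filter_upwards [ae_transition_ne_zero ν P] with ω hω n hn m hm
  induction m, hm using Nat.le_induction with
  | base => exact hn
  | succ m _ ih => exact hC _ ih _ (hω m)

lemma integral_mul_compensated (ν : PMF X) (P : X → PMF X) (v : X → ℝ) {n : ℕ}
    {Φ : (ℕ → X) → ℝ} (hΦ : DependsOn Φ (Set.Iic n)) :
    ∫ ω, Φ ω * (v (ω (n + 1)) - transOp P v (ω n)) ∂(markovLaw ν P) = 0 := by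
  have h := integral_mul_markovLaw_succ ν P hΦ fun x y => v y - transOp P v x
  simpa only [pmfMean_compensated, mul_zero, integral_zero] using h

lemma martingale_compensatedSum (ν : PMF X) (P : X → PMF X) (v : X → ℝ) (w : ℕ → ℝ) :
    Martingale (compensatedSum P v w) (Filtration.piLE (X := fun _ : ℕ => X)) (markovLaw ν P) := by
  classical
  have hInt := fun n => (dependsOn_compensatedSum P v w n).integrable_markovLaw ν P
  refine martingale_of_condExp_sub_eq_zero_nat
    (fun n => (dependsOn_compensatedSum P v w n).stronglyMeasurable_piLE) hInt fun n => ?_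
  refine (ae_eq_condExp_of_forall_setIntegral_eq (Filtration.piLE.le n)
    ((hInt (n + 1)).sub (hInt n)) (fun s _ _ => (integrable_zero _ _ _).integrableOn) ?_
    aestronglyMeasurable_zero).symm
  intro s hs _
  rw [Filtration.piLE_eq_comap_frestrictLe] at hs
  obtain ⟨t, ht, rfl⟩ := hs
  -- The weight times the indicator of a past event is a function of the past, so it is orthogonal
  -- to the compensated increment.
  have hdep : DependsOn
      (fun ω : ℕ → X => w n * Set.indicator t (fun _ => (1 : ℝ)) fun k : Finset.Iic n => ω k)
      (Set.Iic n) := fun ω ω' h => by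
    have : (fun k : Finset.Iic n => ω k) = fun k : Finset.Iic n => ω' k :=
      funext fun k => h k (Finset.mem_Iic.1 k.2)
    simp only [this]
  simp only [Pi.zero_apply, integral_zero]
  rw [← integral_indicator (ht.preimage (by fun_prop))]
  refine ((integral_mul_compensated ν P v hdep).symm.trans
    (integral_congr_ae (Eventually.of_forall fun ω => ?_)))
  have hmem : ((Preorder.frestrictLe n ω : Finset.Iic n → X) ∈ t) =
    ((fun k : Finset.Iic n => ω k) ∈ t) := rfl
  simp only [Set.indicator_apply, Set.mem_preimage, hmem, Pi.sub_apply, compensatedSum,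
    Finset.sum_range_succ]
  split_ifs <;> ring

/-- A compensated sum that is bounded in `L²` converges almost surely. -/
lemma ae_exists_tendsto_compensatedSum (ν : PMF X) (P : X → PMF X) (v : X → ℝ) (w : ℕ → ℝ) {b : ℝ}
    (hb : ∀ n, ∫ ω, compensatedSum P v w n ω ^ 2 ∂(markovLaw ν P) ≤ b) :
    ∀ᵐ ω ∂(markovLaw ν P), ∃ l, Tendsto (fun n => compensatedSum P v w n ω) atTop (𝓝 l) := by
  -- Submartingale convergence asks for a bound in `L¹`; `|x| ≤ 1 + x²` supplies `1 + b`.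
  refine (martingale_compensatedSum ν P v w).submartingale.exists_ae_tendsto_of_bdd
    (R := (1 + b).toNNReal) fun n => ?_
  have hdep := dependsOn_compensatedSum P v w n
  have hInt := hdep.integrable_markovLaw ν P
  have hint2 : Integrable (fun ω => compensatedSum P v w n ω ^ 2) (markovLaw ν P) :=
    DependsOn.integrable_markovLaw (n := n) (fun ω ω' h => by simp only [hdep h]) ν P
  rw [eLpNorm_one_eq_lintegral_enorm, ← ofReal_integral_norm_eq_lintegral_enorm hInt]
  refine ENNReal.ofReal_le_ofReal ?_
  calc ∫ ω, ‖compensatedSum P v w n ω‖ ∂(markovLaw ν P)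
      ≤ ∫ ω, (1 + compensatedSum P v w n ω ^ 2) ∂(markovLaw ν P) := by
        refine integral_mono hInt.norm ((integrable_const _).add hint2) fun ω => ?_
        rw [Real.norm_eq_abs, ← sq_abs]
        nlinarith [sq_nonneg (|compensatedSum P v w n ω| - 1)]
    _ ≤ 1 + b := by
        rw [integral_add (integrable_const _) hint2]
        simpa using hb n

/-- Compensated increments are orthogonal to the past, so the cross terms vanish and second moments
add up; each increment is at most `2 * b` in absolute value. -/
lemma integral_compensatedSum_sq_le (ν : PMF X) (P : X → PMF X) {v : X → ℝ} {b : ℝ}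
    (hb : ∀ x, |v x| ≤ b) (w : ℕ → ℝ) (n : ℕ) :
    ∫ ω, compensatedSum P v w n ω ^ 2 ∂(markovLaw ν P) ≤
      ∑ k ∈ Finset.range n, w k ^ 2 * (2 * b) ^ 2 := by
  induction n with
  | zero => simp [compensatedSum]
  | succ n ih =>
    have hdep := dependsOn_compensatedSum P v w n
    have hD : ∀ ω : ℕ → X, (w n * (v (ω (n + 1)) - transOp P v (ω n))) ^ 2 ≤
        w n ^ 2 * (2 * b) ^ 2 := fun ω => by
      rw [mul_pow]
      refine mul_le_mul_of_nonneg_left (sq_le_sq' ?_ ?_) (sq_nonneg _)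
      all_goals
        have h1 := abs_le.1 (hb (ω (n + 1)))
        have h2 := abs_le.1 (abs_pmfMean_le (p := P (ω n)) hb)
        rw [transOp_apply]
        linarith [h1.1, h1.2, h2.1, h2.2]
    have hN2 : Integrable (fun ω => compensatedSum P v w n ω ^ 2) (markovLaw ν P) :=
      DependsOn.integrable_markovLaw (n := n) (fun ω ω' h => by simp only [hdep h]) ν P
    have hND : Integrable (fun ω => (2 * w n * compensatedSum P v w n ω) *
        (v (ω (n + 1)) - transOp P v (ω n))) (markovLaw ν P) :=
      DependsOn.integrable_markovLaw (n := n + 1) (fun ω ω' h => by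
        simp only [hdep fun i hi => h i (Set.mem_Iic.2 ((Set.mem_Iic.1 hi).trans n.le_succ)),
          h n (Set.mem_Iic.2 n.le_succ), h (n + 1) (Set.mem_Iic.2 le_rfl)]) ν P
    have hD2 : Integrable (fun ω : ℕ → X => (w n * (v (ω (n + 1)) - transOp P v (ω n))) ^ 2)
        (markovLaw ν P) :=
      DependsOn.integrable_markovLaw (n := n + 1) (fun ω ω' h => by
        simp only [h n (Set.mem_Iic.2 n.le_succ), h (n + 1) (Set.mem_Iic.2 le_rfl)]) ν P
    have hexp : ∀ ω, compensatedSum P v w (n + 1) ω ^ 2 =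
        (compensatedSum P v w n ω ^ 2 + (2 * w n * compensatedSum P v w n ω) *
          (v (ω (n + 1)) - transOp P v (ω n))) +
          (w n * (v (ω (n + 1)) - transOp P v (ω n))) ^ 2 := fun ω => by
      rw [compensatedSum, Finset.sum_range_succ, ← compensatedSum]
      ring
    have hzero := integral_mul_compensated ν P v (n := n)
      (Φ := fun ω => 2 * w n * compensatedSum P v w n ω) (fun ω ω' h => by simp only [hdep h])
    simp only [hexp]
    refine (integral_add (hN2.add hND) hD2).le.trans ?_
    rw [integral_add' hN2 hND, hzero, add_zero, Finset.sum_range_succ]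
    refine add_le_add ih ?_
    refine (integral_mono hD2 (integrable_const _) hD).trans ?_
    simp

/-- Kronecker's lemma for the weights `1 / (k + 1)`. -/
lemma tendsto_average_zero_of_tendsto_weighted {a : ℕ → ℝ} {l : ℝ}
    (h : Tendsto (fun n => ∑ k ∈ Finset.range n, (1 / ((k : ℝ) + 1)) * a k) atTop (𝓝 l)) :
    Tendsto (fun n : ℕ => (n : ℝ)⁻¹ * ∑ k ∈ Finset.range n, a k) atTop (𝓝 0) := by
  set s : ℕ → ℝ := fun n => ∑ k ∈ Finset.range n, (1 / ((k : ℝ) + 1)) * a k with hs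
  -- Summation by parts. After division by `n`, both `s n` and the Cesàro mean of `s` tend to `l`.
  have hsum : ∀ n : ℕ, ∑ k ∈ Finset.range n, a k = n * s n - ∑ k ∈ Finset.range n, s k := fun n => by
    induction n with
    | zero => simp
    | succ n ih =>
      have hn : ((n : ℝ) + 1) ≠ 0 := by positivity
      have : s (n + 1) = s n + (1 / ((n : ℝ) + 1)) * a n := Finset.sum_range_succ _ _
      rw [Finset.sum_range_succ, ih, Finset.sum_range_succ, this]
      push_cast
      field_simp
      ring
  have h1 := h.sub h.cesaro
  rw [sub_self] at h1
  refine h1.congr' ?_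
  filter_upwards [eventually_gt_atTop 0] with n hn
  have : (n : ℝ) ≠ 0 := by positivity
  rw [hsum, mul_sub, inv_mul_cancel_left₀ this]

/-- The averages of the compensated increments vanish almost surely in the limit. -/
lemma ae_tendsto_average_compensated (ν : PMF X) (P : X → PMF X) (v : X → ℝ) :
    ∀ᵐ ω ∂(markovLaw ν P), Tendsto (fun n : ℕ => (n : ℝ)⁻¹ *
      ∑ k ∈ Finset.range n, (v (ω (k + 1)) - transOp P v (ω k))) atTop (𝓝 0) := by
  obtain ⟨b, hb⟩ := exists_abs_le v
  -- Square summability of the Kronecker weights bounds the weighted martingale in `L²`.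
  have hsummable : Summable fun k : ℕ => (1 / ((k : ℝ) + 1)) ^ 2 * (2 * b) ^ 2 := by
    refine Summable.mul_right _ ?_
    have := (summable_nat_add_iff 1).2 (Real.summable_one_div_nat_pow.2 one_lt_two)
    simpa only [div_pow, one_pow, Nat.cast_add, Nat.cast_one] using this
  have := ae_exists_tendsto_compensatedSum ν P v (fun k => 1 / ((k : ℝ) + 1)) fun n =>
    (integral_compensatedSum_sq_le ν P hb _ n).trans
      (hsummable.sum_le_tsum _ fun k _ => by positivity)
  filter_upwards [this] with ω ⟨l, hl⟩
  exact tendsto_average_zero_of_tendsto_weighted hl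

/-- A harmonic function converges along almost every path. -/
lemma ae_exists_tendsto_harmonic (ν : PMF X) {P : X → PMF X} {h : X → ℝ} (hh : transOp P h = h) :
    ∀ᵐ ω ∂(markovLaw ν P), ∃ l, Tendsto (fun n => h (ω n)) atTop (𝓝 l) := by
  obtain ⟨b, hb⟩ := exists_abs_le h
  -- For harmonic `h` the unweighted compensated sum telescopes, so the martingale is bounded.
  have htel : ∀ n (ω : ℕ → X), compensatedSum P h (fun _ => 1) n ω = h (ω n) - h (ω 0) :=
    fun n ω => by
      simp only [compensatedSum, hh, one_mul]
      exact Finset.sum_range_sub (fun k => h (ω k)) n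
  have := ae_exists_tendsto_compensatedSum ν P h (fun _ => 1) (b := (2 * b) ^ 2) fun n => by
    have hle : ∀ ω : ℕ → X, compensatedSum P h (fun _ => 1) n ω ^ 2 ≤ (2 * b) ^ 2 := fun ω => by
      rw [htel]
      have h1 := abs_le.1 (hb (ω n))
      have h2 := abs_le.1 (hb (ω 0))
      exact sq_le_sq' (by linarith [h1.1, h2.2]) (by linarith [h1.2, h2.1])
    have hdep := dependsOn_compensatedSum P h (fun _ => 1) n
    refine (integral_mono (DependsOn.integrable_markovLaw (n := n)
      (fun ω ω' h => by simp only [hdep h]) ν P) (integrable_const _) hle).trans ?_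
    simp
  filter_upwards [this] with ω ⟨l, hl⟩
  refine ⟨l + h (ω 0), (hl.add_const (h (ω 0))).congr fun n => ?_⟩
  rw [htel, sub_add_cancel]

/-- The ergodic theorem for finite Markov chains: the averages of `g` along almost every path
converge to the limit of the harmonic projection of `g` along the path. -/
theorem ae_tendsto_average (ν : PMF X) (P : X → PMF X) (g : X → ℝ) :
    ∀ᵐ ω ∂(markovLaw ν P), ∃ l,
      Tendsto (fun n => harmonicProj P g (ω n)) atTop (𝓝 l) ∧
      Tendsto (fun n : ℕ => (n : ℝ)⁻¹ * ∑ k ∈ Finset.range n, g (ω k)) atTop (𝓝 l) := by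
  obtain ⟨v, hv⟩ := exists_eq_harmonicProj_add P g
  obtain ⟨b, hb⟩ := exists_abs_le v
  filter_upwards [ae_exists_tendsto_harmonic ν (transOp_harmonicProj P g),
    ae_tendsto_average_compensated ν P v] with ω ⟨l, hl⟩ hcomp
  refine ⟨l, hl, ?_⟩
  have hbdd : Tendsto (fun n : ℕ => (n : ℝ)⁻¹ * (v (ω n) - v (ω 0))) atTop (𝓝 0) := by
    refine (tendsto_inv_atTop_nhds_zero_nat (𝕜 := ℝ)).zero_mul_isBoundedUnder_le ?_
    refine isBoundedUnder_of ⟨b + b, fun n => ?_⟩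
    have := hb (ω n)
    have := hb (ω 0)
    have := abs_sub (v (ω n)) (v (ω 0))
    simp only [Function.comp_apply, Real.norm_eq_abs]
    linarith
  -- Uses `P v(ω k) - v(ω k) = (v(ω (k+1)) - v(ω k)) - (v(ω (k+1)) - P v(ω k))`: a telescoping
  -- difference minus a compensated increment.
  have h := (hl.cesaro.sub hcomp).add hbdd
  rw [sub_zero, add_zero] at h
  refine h.congr fun n => ?_
  rw [← mul_sub, ← mul_add, ← Finset.sum_range_sub (fun k => v (ω k)) n, ← Finset.sum_sub_distrib,
    ← Finset.sum_add_distrib]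
  congr 1
  refine Finset.sum_congr rfl fun k _ => ?_
  have := congrFun hv (ω k)
  simp only [Pi.add_apply, Pi.sub_apply] at this
  rw [this]
  ring

end PathMeasure

/-! ### Recurrent classes and empirical frequencies -/

section RecurrentClass

variable {X : Type*} [Fintype X] [MeasurableSpace X] [MeasurableSingletonClass X]

lemma isRecurrentClass_of_mem {P : X → PMF X} {R : Finset X} (h : R ∈ recurrentClasses P) :
    IsRecurrentClass P R := by
  classical
  exact (Finset.mem_filter.1 h).2

lemma IsRecurrentClass.nonempty {P : X → PMF X} {R : Finset X} (h : IsRecurrentClass P R) :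
    R.Nonempty := by
  obtain ⟨⟨x, hx⟩, _⟩ := h
  exact ⟨x, (hx x).2 ⟨.refl, .refl⟩⟩

lemma IsRecurrentClass.mem_iff {P : X → PMF X} {R : Finset X} (h : IsRecurrentClass P R) {x : X}
    (hx : x ∈ R) (y : X) : y ∈ R ↔ Reaches P x y ∧ Reaches P y x := by
  obtain ⟨⟨z, hz⟩, _⟩ := h
  have hzx := (hz x).1 hx
  rw [hz y]
  exact ⟨fun hy => ⟨hzx.2.trans hy.1, hy.2.trans hzx.1⟩,
    fun hy => ⟨hzx.1.trans hy.1, hy.2.trans hzx.2⟩⟩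

lemma IsRecurrentClass.reaches {P : X → PMF X} {R : Finset X} (h : IsRecurrentClass P R) :
    ∀ x ∈ R, ∀ y ∈ R, Reaches P x y := fun _ hx y hy => ((h.mem_iff hx y).1 hy).1

lemma IsRecurrentClass.eq_of_mem {P : X → PMF X} {R R' : Finset X} (h : IsRecurrentClass P R)
    (h' : IsRecurrentClass P R') {x : X} (hx : x ∈ R) (hx' : x ∈ R') : R = R' := by
  ext y
  rw [h.mem_iff hx, h'.mem_iff hx']

/-- No transition of positive probability leaves a recurrent class. -/
lemma IsRecurrentClass.isClosedUnder {P : X → PMF X} {R : Finset X} (h : IsRecurrentClass P R) :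
    IsClosedUnder P R := by
  intro x hx y hxy
  by_contra hy
  have hnr : ¬ Reaches P y x := fun hyx =>
    hy ((h.mem_iff hx y).2 ⟨Relation.ReflTransGen.single hxy, hyx⟩)
  -- The set reachable from `y` is closed and misses `x`. A path from `x` with first step to `y`
  -- never returns, so almost sure return makes that step have probability zero.
  have hC : IsClosedUnder P {z | Reaches P y z} := fun u hu w hw =>
    Relation.ReflTransGen.tail hu hw
  have hmeas : MeasurableSet {ω : ℕ → X | ∃ t : ℕ, 1 ≤ t ∧ ω t = x} := by
    have : {ω : ℕ → X | ∃ t : ℕ, 1 ≤ t ∧ ω t = x} =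
        ⋃ t : ℕ, ⋃ _ : 1 ≤ t, (fun ω : ℕ → X => ω t) ⁻¹' {x} := by
      ext ω
      simp
    rw [this]
    exact MeasurableSet.iUnion fun t => MeasurableSet.iUnion fun _ =>
      measurable_pi_apply t (measurableSet_singleton x)
  have hret := (mem_ae_iff_prob_eq_one hmeas).2 (h.2 x hx)
  have hzero : ∫ ω, Set.indicator {y} (fun _ => (1 : ℝ)) (ω 1) ∂(markovLaw (PMF.pure x) P) = 0 := by
    rw [← integral_zero (ℕ → X) ℝ (μ := markovLaw (PMF.pure x) P)]
    refine integral_congr_ae ?_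
    filter_upwards [hret, ae_mem_of_isClosedUnder (PMF.pure x) hC] with ω ⟨t, ht, htx⟩ hω
    refine Set.indicator_of_notMem (fun hy1 => hnr ?_) _
    have hy1 : ω 1 = y := hy1
    rw [← htx]
    exact hω 1 (by rw [hy1]; exact Relation.ReflTransGen.refl) t ht
  rw [integral_markovLaw_succ (PMF.pure x) P 0 (Set.indicator {y} fun _ => (1 : ℝ)),
    integral_markovLaw_zero, pmfMean_pure, transOp_apply, pmfMean_indicator] at hzero
  exact (ENNReal.toReal_pos hxy ((P x).apply_ne_top y)).ne' hzero

end RecurrentClass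

/-! ### Limits of empirical frequencies and absorption into closed sets -/

section EmpiricalFrequency

variable {X : Type*}

lemma empFreq_nonneg (τ : ℕ → X) (x : X) (H : ℕ) : 0 ≤ empFreq τ x H :=
  mul_nonneg (by positivity)
    (Finset.sum_nonneg fun _ _ => Set.indicator_nonneg (fun _ _ => zero_le_one) _)

lemma empFreq_le_one (τ : ℕ → X) (x : X) (H : ℕ) : empFreq τ x H ≤ 1 := by
  have h : ∑ t ∈ Finset.range H, Set.indicator {x} (fun _ => (1 : ℝ)) (τ t) ≤ H := by
    refine (Finset.sum_le_card_nsmul _ _ 1 fun t _ => ?_).trans (by simp)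
    exact Set.indicator_le_self' (fun _ _ => zero_le_one) _
  rw [empFreq, one_div_mul_eq_div]
  exact div_le_one_of_le₀ h (Nat.cast_nonneg H)

lemma sum_empFreq [Fintype X] (τ : ℕ → X) {H : ℕ} (hH : 0 < H) : ∑ x, empFreq τ x H = 1 := by
  classical
  have hH' : (H : ℝ) ≠ 0 := by positivity
  simp only [empFreq, ← Finset.mul_sum]
  rw [Finset.sum_comm]
  simp [hH']

lemma empOcc_mem_stdSimplex [Fintype X] {τ : ℕ → X}
    (h : ∀ x, Tendsto (empFreq τ x) atTop (𝓝 (empOcc τ x))) : empOcc τ ∈ stdSimplex ℝ X := by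
  refine ⟨fun x => ge_of_tendsto' (h x) (empFreq_nonneg τ x), ?_⟩
  refine tendsto_nhds_unique (tendsto_finsetSum _ fun x _ => h x)
    (tendsto_const_nhds.congr' ?_)
  filter_upwards [eventually_gt_atTop 0] with H hH
  exact (sum_empFreq τ hH).symm

lemma empOcc_eq_zero {τ : ℕ → X} {x : X} (h : ∀ t, τ t ≠ x) : empOcc τ x = 0 := by
  have : empFreq τ x = fun _ => 0 := funext fun H => by
    have h0 : ∀ t, Set.indicator {x} (fun _ => (1 : ℝ)) (τ t) = 0 := fun t =>
      Set.indicator_of_notMem (fun ht : τ t ∈ ({x} : Set X) => h t ht) _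
    simp only [empFreq, h0, Finset.sum_const_zero, mul_zero]
  rw [empOcc, this]
  exact tendsto_const_nhds.limUnder_eq

variable [Fintype X] [MeasurableSpace X] [MeasurableSingletonClass X]

lemma measurable_empFreq (x : X) (H : ℕ) : Measurable fun τ : ℕ → X => empFreq τ x H :=
  (Finset.measurable_sum _ fun t _ => (measurable_of_finite
    (Set.indicator {x} fun _ => (1 : ℝ))).comp (measurable_pi_apply t)).const_mul _

/-- Along almost every path the empirical frequencies converge, and their limit is the limit of
the harmonic projections of the indicators. -/
lemma ae_tendsto_empFreq (ν : PMF X) (P : X → PMF X) :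
    ∀ᵐ τ ∂(markovLaw ν P), ∀ x, Tendsto (empFreq τ x) atTop (𝓝 (empOcc τ x)) ∧
      Tendsto (fun n => harmonicProj P (Set.indicator {x} fun _ => (1 : ℝ)) (τ n)) atTop
        (𝓝 (empOcc τ x)) := by
  rw [ae_all_iff]
  intro x
  filter_upwards [ae_tendsto_average ν P (Set.indicator {x} fun _ => (1 : ℝ))] with τ ⟨l, hl, hl'⟩
  have h : Tendsto (empFreq τ x) atTop (𝓝 l) := by
    unfold empFreq
    simpa only [one_div] using hl'
  rw [empOcc, h.limUnder_eq]
  exact ⟨h, hl⟩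

/-- `empOcc` has a default value on paths whose frequencies diverge; since these form a null set, it
is an almost everywhere limit of measurable functions. -/
lemma aemeasurable_empOcc (ν : PMF X) (P : X → PMF X) (x : X) :
    AEMeasurable (fun τ => empOcc τ x) (markovLaw ν P) := by
  refine aemeasurable_of_tendsto_metrizable_ae atTop
    (fun H => (measurable_empFreq x H).aemeasurable) ?_
  filter_upwards [ae_tendsto_empFreq ν P] with τ hτ using (hτ x).1

/-- Almost surely the empirical occupancy is one of the rows of the harmonic projection. -/
lemma ae_exists_empOcc_eq (ν : PMF X) (P : X → PMF X) :
    ∀ᵐ τ ∂(markovLaw ν P), ∃ y, ∀ x,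
      empOcc τ x = harmonicProj P (Set.indicator {x} fun _ => (1 : ℝ)) y := by
  filter_upwards [ae_tendsto_empFreq ν P] with τ hτ
  have hlim : Tendsto (fun n x => harmonicProj P (Set.indicator {x} fun _ => (1 : ℝ)) (τ n)) atTop
      (𝓝 (empOcc τ)) := tendsto_pi_nhds.2 fun x => (hτ x).2
  -- The rows form a finite, hence closed, set, so a limit of rows is a row.
  obtain ⟨y, hy⟩ := (Set.finite_range fun y x =>
    harmonicProj P (Set.indicator {x} fun _ => (1 : ℝ)) y).isClosed.mem_of_tendsto hlim
      (Eventually.of_forall fun n => ⟨τ n, rfl⟩)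
  exact ⟨y, fun x => (congrFun hy x).symm⟩

lemma ae_abs_empOcc_le_one (ν : PMF X) (P : X → PMF X) (x : X) :
    ∀ᵐ τ ∂(markovLaw ν P), |empOcc τ x| ≤ 1 := by
  filter_upwards [ae_tendsto_empFreq ν P] with τ hτ
  rw [abs_of_nonneg (ge_of_tendsto' (hτ x).1 (empFreq_nonneg τ x))]
  exact le_of_tendsto' (hτ x).1 (empFreq_le_one τ x)

lemma memLp_empOcc (ν : PMF X) (P : X → PMF X) (x : X) :
    MemLp (fun τ => empOcc τ x) 2 (markovLaw ν P) :=
  MemLp.of_bound (aemeasurable_empOcc ν P x).aestronglyMeasurable 1 (ae_abs_empOcc_le_one ν P x)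

lemma integrable_empOcc (ν : PMF X) (P : X → PMF X) (x : X) :
    Integrable (fun τ => empOcc τ x) (markovLaw ν P) :=
  (memLp_empOcc ν P x).integrable one_le_two

lemma real_markovLaw_eq_integral (ν : PMF X) (P : X → PMF X) (C : Set X) (t : ℕ) :
    (markovLaw ν P).real {τ | τ t ∈ C} =
      ∫ τ, Set.indicator C (fun _ => (1 : ℝ)) (τ t) ∂(markovLaw ν P) := by
  have hmeas : MeasurableSet {τ : ℕ → X | τ t ∈ C} :=
    measurable_pi_apply t C.toFinite.measurableSet
  rw [← integral_indicator_one hmeas]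
  rfl

/-- The expected frequencies converge to the mean of the empirical occupancy. -/
lemma tendsto_average_real_markovLaw (ν : PMF X) (P : X → PMF X) (x : X) :
    Tendsto (fun H : ℕ => (1 / (H : ℝ)) *
      ∑ t ∈ Finset.range H, (markovLaw ν P).real {τ | τ t = x}) atTop
      (𝓝 (∫ τ, empOcc τ x ∂(markovLaw ν P))) := by
  have h : ∀ H : ℕ, (1 / (H : ℝ)) * ∑ t ∈ Finset.range H, (markovLaw ν P).real {τ | τ t = x} =
      ∫ τ, empFreq τ x H ∂(markovLaw ν P) := fun H => by
    unfold empFreq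
    rw [integral_const_mul, integral_finsetSum _ fun t _ =>
      integrable_comp_of_finite (Y := X) (measurable_pi_apply t) (Set.indicator {x} fun _ => (1 : ℝ))]
    congr 1
    exact Finset.sum_congr rfl fun t _ => real_markovLaw_eq_integral ν P {x} t
  simp only [h]
  refine tendsto_integral_of_dominated_convergence (fun _ => 1)
    (fun H => (measurable_empFreq x H).aestronglyMeasurable) (integrable_const _)
    (fun H => Eventually.of_forall fun τ => ?_) ?_
  · rw [Real.norm_eq_abs, abs_of_nonneg (empFreq_nonneg τ x H)]
    exact empFreq_le_one τ x H
  · filter_upwards [ae_tendsto_empFreq ν P] with τ hτ using (hτ x).1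

lemma measurableSet_exists_mem (C : Set X) : MeasurableSet {τ : ℕ → X | ∃ t, τ t ∈ C} := by
  have : {τ : ℕ → X | ∃ t, τ t ∈ C} = ⋃ t : ℕ, (fun τ : ℕ → X => τ t) ⁻¹' C := by
    ext τ
    simp
  rw [this]
  exact MeasurableSet.iUnion fun t => measurable_pi_apply t C.toFinite.measurableSet

/-- The probability of being in a closed set converges to the probability of entering it. -/
lemma tendsto_real_mem_of_isClosedUnder (ν : PMF X) {P : X → PMF X} {C : Set X}
    (hC : IsClosedUnder P C) :
    Tendsto (fun t => (markovLaw ν P).real {τ | τ t ∈ C}) atTop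
      (𝓝 ((markovLaw ν P).real {τ | ∃ t, τ t ∈ C})) := by
  classical
  simp only [real_markovLaw_eq_integral]
  rw [← integral_indicator_one (measurableSet_exists_mem C)]
  refine tendsto_integral_of_dominated_convergence (fun _ => 1)
    (fun t => ((measurable_of_finite (Set.indicator C fun _ => (1 : ℝ))).comp
      (measurable_pi_apply t)).aestronglyMeasurable) (integrable_const _)
    (fun t => Eventually.of_forall fun τ => ?_) ?_
  · simp only [Set.indicator_apply]
    split_ifs <;> simp
  · filter_upwards [ae_mem_of_isClosedUnder ν hC] with τ hτ
    by_cases h : ∃ t, τ t ∈ C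
    · rw [Set.indicator_of_mem (show τ ∈ {τ : ℕ → X | ∃ t, τ t ∈ C} from h)]
      obtain ⟨t, ht⟩ := h
      refine tendsto_const_nhds.congr' ?_
      filter_upwards [eventually_ge_atTop t] with m hm
      rw [Set.indicator_of_mem (hτ t ht m hm)]
      rfl
    · rw [Set.indicator_of_notMem (show τ ∉ {τ : ℕ → X | ∃ t, τ t ∈ C} from h)]
      refine tendsto_const_nhds.congr fun m => ?_
      rw [Set.indicator_of_notMem fun hm => h ⟨m, hm⟩]

/-- If the harmonic projection of the indicator of `x ∈ C` is equal to `b` on the closed set `C`,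
then the empirical occupancy of `x` is `b` on the paths that enter `C`, and zero elsewhere. -/
lemma ae_empOcc_eq_of_isClosedUnder (ν : PMF X) {P : X → PMF X} {C : Set X}
    (hC : IsClosedUnder P C) {x : X} (hx : x ∈ C) {b : ℝ}
    (hb : ∀ y ∈ C, harmonicProj P (Set.indicator {x} fun _ => (1 : ℝ)) y = b) :
    ∀ᵐ τ ∂(markovLaw ν P),
      empOcc τ x = Set.indicator {τ : ℕ → X | ∃ t, τ t ∈ C} (fun _ => b) τ := by
  filter_upwards [ae_tendsto_empFreq ν P, ae_mem_of_isClosedUnder ν hC] with τ hτ hmem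
  by_cases h : ∃ t, τ t ∈ C
  · rw [Set.indicator_of_mem (show τ ∈ {τ : ℕ → X | ∃ t, τ t ∈ C} from h)]
    obtain ⟨t, ht⟩ := h
    refine tendsto_nhds_unique (hτ x).2 (tendsto_const_nhds.congr' ?_)
    filter_upwards [eventually_ge_atTop t] with m hm
    exact (hb _ (hmem t ht m hm)).symm
  · rw [Set.indicator_of_notMem (show τ ∉ {τ : ℕ → X | ∃ t, τ t ∈ C} from h)]
    exact empOcc_eq_zero fun t ht => h ⟨t, ht ▸ hx⟩

end EmpiricalFrequency

lemma variance_of_ae_eq_indicator {Ω : Type*} [MeasurableSpace Ω] {μ : Measure Ω}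
    [IsProbabilityMeasure μ] {B : Set Ω} (hB : MeasurableSet B) {b : ℝ} {Z : Ω → ℝ}
    (hZ : ∀ᵐ ω ∂μ, Z ω = Set.indicator B (fun _ => b) ω) :
    variance Z μ = μ.real B * (1 - μ.real B) * b ^ 2 := by
  have hmem : MemLp (Set.indicator B fun _ => b) 2 μ := (memLp_const b).indicator hB
  rw [variance_congr hZ, variance_eq_sub hmem]
  have hsq : (Set.indicator B fun _ => b) ^ 2 = Set.indicator B fun _ => b ^ 2 := by
    classical
    ext ω
    simp only [Pi.pow_apply, Set.indicator_apply]
    split_ifs <;> simp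
  rw [hsq, integral_indicator_const _ hB, integral_indicator_const _ hB, smul_eq_mul, smul_eq_mul]
  ring

/-! ### Jensen's inequality for finitely valued random vectors -/

section Jensen

variable {Ω : Type*} [MeasurableSpace Ω] {μ : Measure Ω} [IsProbabilityMeasure μ]

/-- Almost everywhere `φ ∘ D` is a finite sum of constants on the null-measurable level sets of `D`,
so nothing is asked of `φ`. This covers a utility that is not known to be measurable. -/
lemma integral_comp_of_ae_mem_finset {E G : Type*} [MeasurableSpace E] [MeasurableSingletonClass E]
    [NormedAddCommGroup G] [NormedSpace ℝ G] [CompleteSpace G] {D : Ω → E} (hD : AEMeasurable D μ)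
    {F : Finset E} (hF : ∀ᵐ ω ∂μ, D ω ∈ F) (φ : E → G) :
    Integrable (fun ω => φ (D ω)) μ ∧
      ∫ ω, φ (D ω) ∂μ = ∑ d ∈ F, μ.real (D ⁻¹' {d}) • φ d := by
  classical
  have hae : (fun ω => φ (D ω)) =ᵐ[μ]
      fun ω => ∑ d ∈ F, Set.indicator (D ⁻¹' {d}) (fun _ => φ d) ω := by
    filter_upwards [hF] with ω hω
    simp [Set.indicator_apply, hω]
  have hnull : ∀ d, NullMeasurableSet (D ⁻¹' {d}) μ := fun d =>
    hD.nullMeasurableSet_preimage (measurableSet_singleton d)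
  have hInt : ∀ d ∈ F, Integrable (Set.indicator (D ⁻¹' {d}) fun _ => φ d) μ := fun d _ =>
    (integrable_const (φ d)).indicator₀ (hnull d)
  refine ⟨(integrable_finsetSum F hInt).congr hae.symm, ?_⟩
  rw [integral_congr_ae hae, integral_finsetSum F hInt]
  refine Finset.sum_congr rfl fun d _ => ?_
  rw [integral_indicator₀ (hnull d), setIntegral_const]

/-- Jensen's inequality for strongly convex functions, with the variance as the gap. -/
lemma StrongConvexOn.variance_le_jensen_gap {Y : Type*} [Fintype Y]
    {s : Set (EuclideanSpace ℝ Y)} {c : ℝ} {f : EuclideanSpace ℝ Y → ℝ}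
    (hf : StrongConvexOn s c f) {D : Ω → EuclideanSpace ℝ Y} (hD : AEMeasurable D μ)
    {F : Finset (EuclideanSpace ℝ Y)} (hF : ∀ᵐ ω ∂μ, D ω ∈ F) (hs : ∀ d ∈ F, d ∈ s) :
    c / 2 * ∑ y, variance (fun ω => D ω y) μ ≤
      ∫ ω, f (D ω) ∂μ - f (WithLp.toLp 2 fun y => ∫ ω, D ω y ∂μ) := by
  have hconv := strongConvexOn_iff_convex.1 hf
  have hone : ∑ d ∈ F, μ.real (D ⁻¹' {d}) = 1 := by
    have := (integral_comp_of_ae_mem_finset hD hF fun _ => (1 : ℝ)).2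
    simpa using this.symm
  have hmean : ∑ d ∈ F, μ.real (D ⁻¹' {d}) • d = WithLp.toLp 2 fun y => ∫ ω, D ω y ∂μ := by
    ext y
    have := (integral_comp_of_ae_mem_finset hD hF fun d => d y).2
    simp [this]
  have hJ := hconv.map_sum_le (t := F) (w := fun d => μ.real (D ⁻¹' {d})) (p := id)
    (fun _ _ => measureReal_nonneg) hone hs
  simp only [id] at hJ
  rw [hmean, ← (integral_comp_of_ae_mem_finset hD hF fun d => f d - c / 2 * ‖d‖ ^ 2).2,
    integral_sub (integral_comp_of_ae_mem_finset hD hF f).1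
      (integral_comp_of_ae_mem_finset hD hF fun d => c / 2 * ‖d‖ ^ 2).1, integral_const_mul] at hJ
  have hvar : ∀ y, variance (fun ω => D ω y) μ =
      ∫ ω, (D ω y) ^ 2 ∂μ - (∫ ω, D ω y ∂μ) ^ 2 := fun y => by
    refine variance_eq_sub ?_
    rw [memLp_two_iff_integrable_sq
      (integral_comp_of_ae_mem_finset hD hF fun d => d y).1.aestronglyMeasurable]
    exact (integral_comp_of_ae_mem_finset hD hF fun d => d y ^ 2).1
  have hnorm : ∫ ω, ‖D ω‖ ^ 2 ∂μ = ∑ y, ∫ ω, (D ω y) ^ 2 ∂μ := by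
    simp only [EuclideanSpace.real_norm_sq_eq]
    exact integral_finsetSum _ fun y _ =>
      (integral_comp_of_ae_mem_finset hD hF fun d => d y ^ 2).1
  rw [hnorm, EuclideanSpace.real_norm_sq_eq] at hJ
  simp only [hvar, Finset.sum_sub_distrib]
  linarith

end Jensen

/-! ### The state-action chain of a stationary policy -/

namespace GUMDP

section StateAction

variable {S A : Type*} [Fintype S] [Fintype A]

lemma pmfMean_withAction (π : S → PMF A) (ν : PMF S) (g : S × A → ℝ) :
    pmfMean (withAction π ν) g = pmfMean ν fun s => pmfMean (π s) fun a => g (s, a) := by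
  simp only [withAction, pmfMean_bind, pmfMean_map]

lemma withAction_apply_toReal (π : S → PMF A) (ν : PMF S) (s : S) (a : A) :
    (withAction π ν (s, a)).toReal = (ν s).toReal * (π s a).toReal := by
  classical
  rw [← pmfMean_indicator, pmfMean_withAction, pmfMean, Finset.sum_eq_single s]
  · congr 1
    rw [← pmfMean_indicator]
    exact pmfMean_congr fun b _ => by simp [Set.indicator_apply]
  · intro s' _ hs'
    rw [← mul_zero (ν s').toReal, ← pmfMean_const (π s') 0]
    congr 1
    exact pmfMean_congr fun b _ => by simp [hs']
  · simp

lemma withAction_apply_ne_zero {π : S → PMF A} {ν : PMF S} {z : S × A} :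
    withAction π ν z ≠ 0 ↔ ν z.1 ≠ 0 ∧ π z.1 z.2 ≠ 0 := by
  rw [← PMF.toReal_apply_ne_zero, ← PMF.toReal_apply_ne_zero, ← PMF.toReal_apply_ne_zero,
    withAction_apply_toReal, mul_ne_zero_iff]

/-- The transition probabilities of the state-action chain. -/
def pairKernel (M : GUMDP S A) (π : S → PMF A) (z : S × A) : PMF (S × A) :=
  withAction π (M.trans z.1 z.2)

/-- Averaging over the action intertwines the operators of the pair chain and the state chain;
stationarity, harmonicity and one-time marginals are transferred through it. -/
lemma pmfMean_transOp_pairKernel (M : GUMDP S A) (π : S → PMF A) (g : S × A → ℝ) (s : S) :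
    pmfMean (π s) (fun a => transOp (M.pairKernel π) g (s, a)) =
      transOp (M.policyKernel π) (fun s => pmfMean (π s) fun a => g (s, a)) s := by
  simp only [transOp_apply, pairKernel, pmfMean_withAction, policyKernel, pmfMean_bind]

lemma policyKernel_apply_ne_zero {M : GUMDP S A} {π : S → PMF A} {s s' : S} {a : A}
    (ha : π s a ≠ 0) (hs : M.trans s a s' ≠ 0) : M.policyKernel π s s' ≠ 0 := by
  rw [policyKernel, ← PMF.mem_support_iff, PMF.mem_support_bind_iff]
  exact ⟨a, (PMF.mem_support_iff _ _).2 ha, (PMF.mem_support_iff _ _).2 hs⟩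

/-- The state-action pairs over `R` that the policy can play. -/
def playable (π : S → PMF A) (R : Finset S) : Set (S × A) :=
  {z | z.1 ∈ R ∧ π z.1 z.2 ≠ 0}

/-- Positivity of `π s a` is essential: only then is a move after `(s, a)` a move of the state
chain. An action that the policy never plays could lead out of `R`. -/
lemma isClosedUnder_playable {M : GUMDP S A} {π : S → PMF A} {R : Finset S}
    (hR : IsClosedUnder (M.policyKernel π) R) :
    IsClosedUnder (M.pairKernel π) (playable π R) := by
  rintro ⟨s, a⟩ ⟨hs, ha⟩ ⟨s', a'⟩ h
  obtain ⟨h1, h2⟩ := withAction_apply_ne_zero.1 h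
  exact ⟨hR s hs s' (policyKernel_apply_ne_zero ha h1), h2⟩

lemma pmfMean_indicator_playable {S A : Type*} [Fintype A] (π : S → PMF A) (R : Finset S) (s : S) :
    pmfMean (π s) (fun a => Set.indicator (playable π R) (fun _ => (1 : ℝ)) (s, a)) =
      Set.indicator (R : Set S) (fun _ => (1 : ℝ)) s := by
  classical
  by_cases hs : s ∈ R
  · rw [Set.indicator_of_mem (Finset.mem_coe.2 hs)]
    exact (pmfMean_congr fun a ha =>
      Set.indicator_of_mem (show (s, a) ∈ playable π R from ⟨hs, ha⟩) _).trans (pmfMean_const _ 1)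
  · rw [Set.indicator_of_notMem (fun h => hs (Finset.mem_coe.1 h)), ← pmfMean_const (π s) 0]
    exact pmfMean_congr fun a _ => Set.indicator_of_notMem (fun h => hs h.1) _

lemma withAction_stationary {M : GUMDP S A} {π : S → PMF A} {μ : PMF S}
    (hμ : μ.bind (M.policyKernel π) = μ) :
    (withAction π μ).bind (M.pairKernel π) = withAction π μ := by
  refine PMF.ext_of_pmfMean fun y => ?_
  rw [pmfMean_bind, pmfMean_withAction, pmfMean_withAction]
  exact (congrArg (pmfMean μ) (funext fun s => pmfMean_transOp_pairKernel M π _ s)).trans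
    (pmfMean_transOp_of_stationary hμ _)

/-- On the playable pairs over a closed communicating class with stationary distribution `μ`, the
harmonic projection of the indicator of `(s, a)` is the constant `π(a|s) μ(s)`. -/
lemma harmonicProj_eq_of_mem_playable {M : GUMDP S A} {π : S → PMF A} {R : Finset S} {μ : PMF S}
    (hC : IsClosedUnder (M.policyKernel π) R)
    (hR : ∀ x ∈ R, ∀ y ∈ R, Reaches (M.policyKernel π) x y)
    (hμ : IsStationaryOn (M.policyKernel π) R μ) (s : S) (a : A) {z : S × A}
    (hz : z ∈ playable π R) :
    harmonicProj (M.pairKernel π) (Set.indicator {(s, a)} fun _ => (1 : ℝ)) z =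
      (π s a).toReal * (μ s).toReal := by
  set h := harmonicProj (M.pairKernel π) (Set.indicator {(s, a)} fun _ => (1 : ℝ)) with hdef
  have hh : transOp (M.pairKernel π) h = h := transOp_harmonicProj _ _
  set k : S → ℝ := fun s => pmfMean (π s) fun a => h (s, a) with hk
  have hkh : ∀ s, pmfMean (M.policyKernel π s) k = k s := fun s => by
    have := pmfMean_transOp_pairKernel M π h s
    rw [hh] at this
    exact this.symm
  -- After one step, `h y` is a mean of `k` over successors in `R`, where the harmonic function `k`
  -- is constant.
  have hconst : ∀ y ∈ playable π R, h y = k z.1 := fun y hy => by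
    have h1 : h y = pmfMean (M.trans y.1 y.2) k := by
      conv_lhs => rw [← hh, transOp_apply, pairKernel, pmfMean_withAction]
    rw [h1, ← pmfMean_const (M.trans y.1 y.2) (k z.1)]
    refine pmfMean_congr fun s' hs' => ?_
    exact harmonic_eq_of_isClosedUnder hC hR (fun s _ => hkh s)
      (hC y.1 hy.1 s' (policyKernel_apply_ne_zero hy.2 hs')) hz.1
  have hsupp : ∀ y, withAction π μ y ≠ 0 → y ∈ playable π R := fun y hy => by
    obtain ⟨h1, h2⟩ := withAction_apply_ne_zero.1 hy
    exact ⟨not_imp_comm.1 (hμ.2 y.1) h1, h2⟩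
  have := pmfMean_eq_of_stationary (withAction_stationary hμ.1) hsupp hconst
  rw [hconst z hz, ← this, pmfMean_indicator, withAction_apply_toReal, mul_comm]

variable [MeasurableSpace S] [MeasurableSingletonClass S]
  [MeasurableSpace A] [MeasurableSingletonClass A]

/-- Only marginals at a single time are compared, so induction with `g` general and the intertwining
relation suffice; no coupling of the two path measures is needed. -/
lemma integral_trajLaw_eq (M : GUMDP S A) (π : S → PMF A) (t : ℕ) (g : S × A → ℝ) :
    ∫ τ, g (τ t) ∂(M.trajLaw π) =
      ∫ ω, pmfMean (π (ω t)) (fun a => g (ω t, a)) ∂(markovLaw M.init (M.policyKernel π)) := by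
  induction t generalizing g with
  | zero =>
    rw [trajLaw, integral_markovLaw_zero, pmfMean_withAction,
      integral_markovLaw_zero M.init (M.policyKernel π) fun s => pmfMean (π s) fun a => g (s, a)]
  | succ t ih =>
    rw [trajLaw, integral_markovLaw_succ,
      integral_markovLaw_succ M.init (M.policyKernel π) t
        fun s => pmfMean (π s) fun a => g (s, a)]
    refine (ih _).trans ?_
    simp only [← pmfMean_transOp_pairKernel]
    rfl

lemma probIn_eq_real_trajLaw (M : GUMDP S A) (π : S → PMF A) (R : Finset S) (t : ℕ) :
    probIn M.init (M.policyKernel π) R t = (M.trajLaw π).real {τ | τ t ∈ playable π R} := by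
  rw [trajLaw, real_markovLaw_eq_integral]
  refine Eq.trans ?_ (integral_trajLaw_eq M π t _).symm
  simp only [pmfMean_indicator_playable]
  exact real_markovLaw_eq_integral M.init (M.policyKernel π) (R : Set S) t

lemma tendsto_probIn {M : GUMDP S A} {π : S → PMF A} {R : Finset S}
    (hC : IsClosedUnder (M.policyKernel π) R) :
    Tendsto (probIn M.init (M.policyKernel π) R) atTop
      (𝓝 ((M.trajLaw π).real {τ | ∃ t, τ t ∈ playable π R})) := by
  rw [funext (probIn_eq_real_trajLaw M π R)]
  exact tendsto_real_mem_of_isClosedUnder (P := M.pairKernel π) _ (isClosedUnder_playable hC)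

lemma absorptionProb_eq {M : GUMDP S A} {π : S → PMF A} {R : Finset S}
    (hC : IsClosedUnder (M.policyKernel π) R) :
    absorptionProb M.init (M.policyKernel π) R =
      (M.trajLaw π).real {τ | ∃ t, τ t ∈ playable π R} :=
  (tendsto_probIn hC).limUnder_eq

instance trajLaw.instIsProbabilityMeasure (M : GUMDP S A) (π : S → PMF A) :
    IsProbabilityMeasure (M.trajLaw π) :=
  inferInstanceAs (IsProbabilityMeasure (markovLaw _ _))

instance trialsLaw.instIsProbabilityMeasure (M : GUMDP S A) (π : S → PMF A) (K : ℕ) :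
    IsProbabilityMeasure (M.trialsLaw π K) :=
  inferInstanceAs (IsProbabilityMeasure (Measure.pi fun _ => M.trajLaw π))

/-- The empirical occupancy of a playable pair over a recurrent class is a multiple of a Bernoulli
variable whose parameter is the absorption probability. -/
lemma variance_empOcc {M : GUMDP S A} {π : S → PMF A} {R : Finset S} {μ : PMF S}
    (hC : IsClosedUnder (M.policyKernel π) R)
    (hR : ∀ x ∈ R, ∀ y ∈ R, Reaches (M.policyKernel π) x y)
    (hμ : IsStationaryOn (M.policyKernel π) R μ) {s : S} (hs : s ∈ R) {a : A} (ha : π s a ≠ 0) :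
    variance (fun τ => empOcc τ (s, a)) (M.trajLaw π) =
      absorptionProb M.init (M.policyKernel π) R *
        (1 - absorptionProb M.init (M.policyKernel π) R) *
        ((π s a).toReal ^ 2 * (μ s).toReal ^ 2) := by
  rw [absorptionProb_eq hC, ← mul_pow]
  exact variance_of_ae_eq_indicator (measurableSet_exists_mem _)
    (ae_empOcc_eq_of_isClosedUnder (P := M.pairKernel π) _ (isClosedUnder_playable hC)
      (show (s, a) ∈ playable π R from ⟨hs, ha⟩)
      fun z hz => harmonicProj_eq_of_mem_playable hC hR hμ s a hz)

lemma sum_le_sum_variance_empOcc (M : GUMDP S A) (π : S → PMF A) {μ : Finset S → PMF S}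
    (hμ : ∀ R ∈ recurrentClasses (M.policyKernel π),
      IsStationaryOn (M.policyKernel π) R (μ R)) :
    ∑ R ∈ recurrentClasses (M.policyKernel π),
      absorptionProb M.init (M.policyKernel π) R *
        (1 - absorptionProb M.init (M.policyKernel π) R) *
        ∑ s ∈ R, ∑ a, (π s a).toReal ^ 2 * (μ R s).toReal ^ 2 ≤
    ∑ z, variance (fun τ => empOcc τ z) (M.trajLaw π) := by
  classical
  have hrec : ∀ R ∈ recurrentClasses (M.policyKernel π), IsRecurrentClass (M.policyKernel π) R :=
    fun _ => isRecurrentClass_of_mem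
  have hdisj : Set.PairwiseDisjoint (recurrentClasses (M.policyKernel π) : Set (Finset S)) id :=
    fun R hR R' hR' hne => Finset.disjoint_left.2 fun s hs hs' =>
      hne ((hrec R hR).eq_of_mem (hrec R' hR') hs hs')
  calc _ ≤ ∑ R ∈ recurrentClasses (M.policyKernel π), ∑ s ∈ R, ∑ a,
        variance (fun τ => empOcc τ (s, a)) (M.trajLaw π) := by
        refine Finset.sum_le_sum fun R hR => ?_
        simp only [Finset.mul_sum]
        refine Finset.sum_le_sum fun s hs => Finset.sum_le_sum fun a _ => ?_
        -- Pairs that are never played contribute zero to the lower bound.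
        by_cases ha : π s a = 0
        · simp [ha, variance_nonneg]
        · exact (variance_empOcc (hrec R hR).isClosedUnder (hrec R hR).reaches (hμ R hR) hs ha).ge
    _ = ∑ s ∈ (recurrentClasses (M.policyKernel π)).biUnion id, ∑ a,
        variance (fun τ => empOcc τ (s, a)) (M.trajLaw π) := (Finset.sum_biUnion hdisj).symm
    _ ≤ ∑ s, ∑ a, variance (fun τ => empOcc τ (s, a)) (M.trajLaw π) :=
        Finset.sum_le_sum_of_subset_of_nonneg (Finset.subset_univ _) fun s _ _ =>
          Finset.sum_nonneg fun a _ => variance_nonneg _ _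
    _ = _ := (Fintype.sum_prod_type
        fun z : S × A => variance (fun τ => empOcc τ z) (M.trajLaw π)).symm

lemma tendsto_expFreq (M : GUMDP S A) (π : S → PMF A) (z : S × A) :
    Tendsto (M.expFreq π z) atTop (𝓝 (∫ τ, empOcc τ z ∂(M.trajLaw π))) :=
  tendsto_average_real_markovLaw _ _ z

lemma avgOcc_apply (M : GUMDP S A) (π : S → PMF A) (z : S × A) :
    M.avgOcc π z = ∫ τ, empOcc τ z ∂(M.trajLaw π) :=
  (M.tendsto_expFreq π z).limUnder_eq

lemma integral_empOccTrials (M : GUMDP S A) (π : S → PMF A) {K : ℕ} (hK : 1 ≤ K) (z : S × A) :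
    ∫ T, empOccTrials T z ∂(M.trialsLaw π K) = ∫ τ, empOcc τ z ∂(M.trajLaw π) := by
  have hInt : Integrable (fun τ => empOcc τ z) (M.trajLaw π) := integrable_empOcc _ _ z
  have hK' : (K : ℝ) ≠ 0 := by positivity
  simp only [empOccTrials]
  have hInt' : ∀ k : Fin K, Integrable (fun T : Fin K → ℕ → S × A => empOcc (T k) z)
      (Measure.pi fun _ => M.trajLaw π) := fun k =>
    integrable_comp_eval (μ := fun _ => M.trajLaw π) (i := k) hInt
  rw [integral_const_mul, trialsLaw, integral_finsetSum _ fun k _ => hInt' k]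
  have h : ∀ k : Fin K, ∫ T, empOcc (T k) z ∂(Measure.pi fun _ => M.trajLaw π) =
      ∫ τ, empOcc τ z ∂(M.trajLaw π) := fun k =>
    integral_comp_eval (μ := fun _ => M.trajLaw π) (i := k) hInt.aestronglyMeasurable
  simp [h, hK']

lemma variance_empOccTrials (M : GUMDP S A) (π : S → PMF A) {K : ℕ} (hK : 1 ≤ K) (z : S × A) :
    variance (fun T => empOccTrials T z) (M.trialsLaw π K) =
      1 / (K : ℝ) * variance (fun τ => empOcc τ z) (M.trajLaw π) := by
  have hK' : (K : ℝ) ≠ 0 := by positivity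
  have hmem : MemLp (fun τ => empOcc τ z) 2 (M.trajLaw π) := memLp_empOcc _ _ z
  have h := variance_sum_pi (ι := Fin K) (μ := fun _ => M.trajLaw π)
    (X := fun _ τ => empOcc τ z) fun _ => hmem
  have hsum : (∑ k : Fin K, fun T : Fin K → ℕ → S × A => empOcc (T k) z) =
      fun T => ∑ k, empOcc (T k) z := by
    ext T
    simp
  rw [hsum] at h
  simp only [empOccTrials]
  rw [variance_const_mul, trialsLaw, h]
  simp
  field_simp

/-- Almost surely the occupancy of `K` trajectories lies in a fixed finite subset of the simplex. -/
lemma exists_finset_ae_empOccTrials_mem (M : GUMDP S A) (π : S → PMF A) {K : ℕ} (hK : 1 ≤ K) :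
    ∃ F : Finset (EuclideanSpace ℝ (S × A)), (∀ d ∈ F, d ∈ probSimplex (S × A)) ∧
      ∀ᵐ T ∂(M.trialsLaw π K), empOccTrials T ∈ F := by
  set G : (Fin K → S × A) → EuclideanSpace ℝ (S × A) := fun y => WithLp.toLp 2 fun z =>
    (1 / (K : ℝ)) * ∑ k, harmonicProj (M.pairKernel π) (Set.indicator {z} fun _ => (1 : ℝ)) (y k)
  -- Each trajectory selects one of finitely many rows. Intersecting with the simplex puts every
  -- point of the finite set where convexity is assumed.
  have hfin : (Set.range G ∩ probSimplex (S × A)).Finite := (Set.finite_range G).inter_of_left _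
  refine ⟨hfin.toFinset, fun d hd => (hfin.mem_toFinset.1 hd).2, ?_⟩
  have hrow : ∀ᵐ T ∂(M.trialsLaw π K), ∀ k, ∃ y, ∀ z,
      empOcc (T k) z = harmonicProj (M.pairKernel π) (Set.indicator {z} fun _ => (1 : ℝ)) y :=
    ae_all_iff.2 fun k => (measurePreserving_eval (fun _ => M.trajLaw π) k).quasiMeasurePreserving.ae
      (ae_exists_empOcc_eq _ (M.pairKernel π))
  have hsimplex : ∀ᵐ T ∂(M.trialsLaw π K), ∀ k, empOcc (T k) ∈ stdSimplex ℝ (S × A) := by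
    refine ae_all_iff.2 fun k =>
      (measurePreserving_eval (fun _ => M.trajLaw π) k).quasiMeasurePreserving.ae
        (p := fun τ => empOcc τ ∈ stdSimplex ℝ (S × A)) ?_
    filter_upwards [ae_tendsto_empFreq (withAction π M.init) (M.pairKernel π)] with τ hτ
    exact empOcc_mem_stdSimplex fun z => (hτ z).1
  filter_upwards [hrow, hsimplex] with T hT hT'
  rw [hfin.mem_toFinset]
  refine ⟨?_, ?_⟩
  · choose y hy using hT
    exact ⟨y, by simp only [G, empOccTrials, hy]⟩
  · have hK' : (K : ℝ) ≠ 0 := by positivity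
    refine ⟨fun z => mul_nonneg (by positivity) (Finset.sum_nonneg fun k _ => (hT' k).1 z), ?_⟩
    simp only [empOccTrials]
    rw [← Finset.mul_sum, Finset.sum_comm]
    simp [(hT' _).2, hK']

lemma aemeasurable_empOccTrials (M : GUMDP S A) (π : S → PMF A) (K : ℕ) :
    AEMeasurable (fun T : Fin K → ℕ → S × A => empOccTrials T) (M.trialsLaw π K) := by
  refine (WithLp.measurable_toLp 2 _).comp_aemeasurable (aemeasurable_pi_lambda _ fun z => ?_)
  refine AEMeasurable.const_mul (Finset.aemeasurable_fun_sum _ fun k _ => ?_) _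
  exact (aemeasurable_empOcc _ (M.pairKernel π) z).comp_quasiMeasurePreserving
    (measurePreserving_eval (fun _ => M.trajLaw π) k).quasiMeasurePreserving

end StateAction

end GUMDP

end

theorem theorem6 {S A : Type*} [Fintype S] [Fintype A]
    [MeasurableSpace S] [MeasurableSingletonClass S]
    [MeasurableSpace A] [MeasurableSingletonClass A]
    (M : GUMDP S A) (c : ℝ) (hc : 0 < c)
    (hf : StrongConvexOn (probSimplex (S × A)) c M.utility)
    (K : ℕ) (hK : 1 ≤ K) (π : S → PMF A) :
    -- every recurrent class carries exactly one stationary distribution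
    (∀ R ∈ recurrentClasses (M.policyKernel π),
      ∃! μ : PMF S, IsStationaryOn (M.policyKernel π) R μ) ∧
    -- the limits and the expectation in the definitions exist
    (∀ R ∈ recurrentClasses (M.policyKernel π),
      Tendsto (probIn M.init (M.policyKernel π) R) atTop
        (𝓝 (absorptionProb M.init (M.policyKernel π) R))) ∧
    (∀ x, Tendsto (M.expFreq π x) atTop (𝓝 (M.avgOcc π x))) ∧
    (∀ᵐ τ ∂(M.trajLaw π), ∀ x, Tendsto (empFreq τ x) atTop (𝓝 (empOcc τ x))) ∧
    Integrable (fun T => M.utility (empOccTrials T)) (M.trialsLaw π K) ∧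
    -- the lower bound
    ∀ μ : Finset S → PMF S,
      (∀ R ∈ recurrentClasses (M.policyKernel π),
        IsStationaryOn (M.policyKernel π) R (μ R)) →
      M.finiteTrials π K - M.infiniteTrials π ≥
        c / (2 * (K : ℝ)) * ∑ R ∈ recurrentClasses (M.policyKernel π),
          absorptionProb M.init (M.policyKernel π) R *
            (1 - absorptionProb M.init (M.policyKernel π) R) *
            ∑ s ∈ R, ∑ a, (π s a).toReal ^ 2 * (μ R s).toReal ^ 2 := by
  have hrec : ∀ R ∈ recurrentClasses (M.policyKernel π), IsRecurrentClass (M.policyKernel π) R :=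
    fun _ => isRecurrentClass_of_mem
  obtain ⟨F, hFs, hF⟩ := M.exists_finset_ae_empOccTrials_mem π hK
  have hD := M.aemeasurable_empOccTrials π K
  refine ⟨fun R hR => existsUnique_isStationaryOn (hrec R hR).nonempty (hrec R hR).isClosedUnder
    (hrec R hR).reaches, fun R hR => ?_, fun x => ?_, ?_,
    (integral_comp_of_ae_mem_finset hD hF M.utility).1, fun μ hμ => ?_⟩
  · rw [GUMDP.absorptionProb_eq (hrec R hR).isClosedUnder]
    exact GUMDP.tendsto_probIn (hrec R hR).isClosedUnder
  · rw [M.avgOcc_apply π x]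
    exact M.tendsto_expFreq π x
  · filter_upwards [ae_tendsto_empFreq (GUMDP.withAction π M.init) (M.pairKernel π)] with τ hτ x
    exact (hτ x).1
  · have hgap := hf.variance_le_jensen_gap hD hF hFs
    have havg : (WithLp.toLp 2 fun z => ∫ T, empOccTrials T z ∂(M.trialsLaw π K)) =
        M.avgOcc π := by
      ext z
      rw [M.avgOcc_apply π z, ← M.integral_empOccTrials π hK z]
    rw [havg] at hgap
    simp only [M.variance_empOccTrials π hK, ← Finset.mul_sum] at hgap
    refine ge_iff_le.2 (le_trans ?_ hgap)
    rw [← mul_assoc, div_mul_div_comm, mul_one]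
    exact mul_le_mul_of_nonneg_left (M.sum_le_sum_variance_empOcc π hμ) (by positivity)
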